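/- Fix a field $F$, parameters $t,\gamma,\delta\in F$, an integer $n\ge 0$, a partition $\lambda=(\lambda_1\ge\dots\ge\lambda_n\ge 0)$ with $n$ parts (zero parts are counted), and $x_1,\dots,x_n\in F^\times$; write $\bar x=1/x$. Assume $x_i^2\ne 1$, $x_i^2\neq t$, and $x_i\ne x_j$, $x_ix_j\ne 1$ for $i\ne j$ (in particular the $x_i$ and $t,\gamma,\delta$ may be independent indeterminates). **Lattice.** Consider the sites $-2,-1$ (boundary) and $0,1,2,\dots$ (bulk). Basis states $|m\rangle$ are finitely supported families of occupation numbers $m_s\in\mathbb Z_{\ge0}$, and at each site $\phi|m\rangle=(1-t^m)|m-1\rangle$, $\phi^\dagger|m\rangle=|m+1\rangle$, $t^{\mathcal N}|m\rangle=t^m|m\rangle$. As matrices over a two-dimensional auxiliary space with basis $e_0$ (hole), $e_1$ (particle), put $$L(x)=\begin{pmatrix}x&x\phi^\dagger\\ \phi&1\end{pmatrix},\qquad B^{(\gamma)}(x)=\begin{pmatrix}t^{\mathcal N}&\gamma x\,\phi^\dagger t^{\mathcal N}\\ \phi&1-\gamma x\,t^{\mathcal N}\end{pmatrix},$$ and let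 $R(x)=B^{(\gamma)}_{-2}(x)B^{(\delta)}_{-1}(x)L_0(x)L_1(x)L_2(x)\cdots$, the subscripts indicating the site on which an operator acts. Let $\langle K|$ be the covector on the tensor square of the auxiliary space with $\langle K|e_0\otimes e_1=1$, $\langle K|e_1\otimes e_0=-t$, $\langle K|e_0\otimes e_0=\langle K|e_1\otimes e_1=0$. The double-row transfer matrix (both right edges occupied by particles) is $$\mathbb T_{--}(x;\gamma,\delta)=R(\bar x)_{1,1}\,R(x)_{0,1}-t\,R(\bar x)_{0,1}\,R(x)_{1,1},$$ where $R(x)_{i,1}$ is the entry in row $e_i$ and column $e_1$; its matrix elements are those of the lattice with bulk sites $0,\dots,N-1$ for every sufficiently large $N$. With $|\lambda\rangle$ the state having $m_i(\lambda)$ particles at bulk site $i\ge0$ and none at the sites $-2,-1$, and $|0\rangle$ the empty state, define $K_\lambda$ by $$\prod_{i=1}^n(x_i-t\bar x_i)\;K_\lambda(x_1^{\pm1},\dots,x_n^{\pm1};t;\gamma,\delta)=\langle\lambda|\,\mathbb T_{--}(x_n;\gamma,\delta)\cdots\mathbb T_{--}(x_1;\gamma,\delta)\,|0\rangle .$$ **Claim.**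 $$K_\lambda(x_1^{\pm1},\dots,x_n^{\pm1};t;\gamma,\delta)=\sum_{\omega\in(S_n/S_n^\lambda)\ltimes\{\pm1\}^n}\omega\left(\prod_{i=1}^n x_i^{\lambda_i}\frac{(1-\gamma\bar x_i)(1-\delta\bar x_i)}{1-\bar x_i^2}\prod_{i,j:\,\lambda_i>\lambda_j}\frac{x_i-tx_j}{x_i-x_j}\prod_{1\le i<j\le n}\frac{1-t\bar x_i\bar x_j}{1-\bar x_i\bar x_j}\right),$$ where $S_n^\lambda\le S_n$ is the stabilizer of $\lambda$, and $\omega=(\sigma S_n^\lambda,\varepsilon)$ runs over all pairs of a coset in $S_n/S_n^\lambda$ and a sign vector $\varepsilon\in\{\pm1\}^n$ and acts by $x_i\mapsto x_{\sigma(i)}^{\varepsilon_{\sigma(i)}}$ (the bracket is invariant under $S_n^\lambda$, so that this does not depend on the choice of $\sigma$). -/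

import Mathlib

namespace BCHL

/-! ### The physical space

Lattice sites: `Sum.inl 0`, `Sum.inl 1` are the boundary sites `-2`, `-1`, and `Sum.inr i` is the
bulk site `i = 0, 1, 2, …`.  A basis state is a finitely supported family of occupation numbers. -/

abbrev Site : Type := Fin 2 ⊕ ℕ

abbrev State : Type := Site →₀ ℕ

/-- Formal, possibly infinite, linear combinations `∑ₘ f m |m⟩` of basis states: the space on which
the operators act, a completion of `V₋₂ ⊗ V₋₁ ⊗ V₀ ⊗ V₁ ⊗ ⋯`.  (A transfer matrix on the infinite
lattice sends one basis state to an infinite combination of basis states.)  The pairing `⟨m|f⟩` is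
the coefficient `f m`. -/
abbrev Space (F : Type*) : Type _ := State → F

variable {F : Type*} [Field F]

/-- The basis vector `|m⟩`. -/
noncomputable def ket (F : Type*) [Field F] (m : State) : Space F := Pi.single m 1

/-- The annihilation operator `φ` at site `s`: `φ |m⟩ = (1 - t ^ mₛ) |m - eₛ⟩`. -/
noncomputable def ann (t : F) (s : Site) : Module.End F (Space F) where
  toFun f := fun m => (1 - t ^ (m s + 1)) * f (m + Finsupp.single s 1)
  map_add' f g := by funext m; simp [mul_add]
  map_smul' c f := by funext m; simp; ring

/-- The creation operator `φ†` at site `s`: `φ† |m⟩ = |m + eₛ⟩`. -/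
noncomputable def cre (s : Site) : Module.End F (Space F) where
  toFun f := fun m => if m s = 0 then 0 else f (m - Finsupp.single s 1)
  map_add' f g := by funext m; by_cases h : m s = 0 <;> simp [h]
  map_smul' c f := by funext m; by_cases h : m s = 0 <;> simp [h]

/-- The operator `t ^ 𝒩` at site `s`, with `𝒩` the particle number: `t ^ 𝒩 |m⟩ = t ^ mₛ |m⟩`. -/
noncomputable def tnum (t : F) (s : Site) : Module.End F (Space F) where
  toFun f := fun m => t ^ m s * f m
  map_add' f g := by funext m; simp [mul_add]
  map_smul' c f := by funext m; simp; ring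

theorem ann_ket (t : F) (s : Site) (m : State) :
    ann t s (ket F m) = (1 - t ^ m s) • ket F (m - Finsupp.single s 1) := by
  funext k
  simp only [ann, ket, LinearMap.coe_mk, AddHom.coe_mk, Pi.smul_apply, smul_eq_mul, Pi.single_apply]
  by_cases h : k + Finsupp.single s 1 = m
  · subst h
    simp
  · rw [if_neg h]
    by_cases h0 : m s = 0
    · simp [h0]
    · rw [if_neg, mul_zero, mul_zero]
      rintro rfl
      apply h
      exact tsub_add_cancel_of_le
        (Finsupp.single_le_iff.2 (Nat.one_le_iff_ne_zero.2 h0))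

theorem cre_ket (s : Site) (m : State) :
    cre s (ket F m) = ket F (m + Finsupp.single s 1) := by
  funext k
  simp only [cre, ket, LinearMap.coe_mk, AddHom.coe_mk, Pi.single_apply]
  by_cases h0 : k s = 0
  · rw [if_pos h0, if_neg]
    rintro rfl
    simp at h0
  · rw [if_neg h0]
    have hle : Finsupp.single s 1 ≤ k :=
      Finsupp.single_le_iff.2 (Nat.one_le_iff_ne_zero.2 h0)
    have : k - Finsupp.single s 1 = m ↔ k = m + Finsupp.single s 1 :=
      tsub_eq_iff_eq_add_of_le hle
    simp [this]

theorem tnum_ket (t : F) (s : Site) (m : State) :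
    tnum t s (ket F m) = t ^ m s • ket F m := by
  funext k
  simp only [tnum, ket, LinearMap.coe_mk, AddHom.coe_mk, Pi.smul_apply, smul_eq_mul,
    Pi.single_apply]
  by_cases h : k = m
  · subst h; simp
  · simp [h]

/-- The `t`-boson relation `φ φ† - t φ† φ = 1 - t`. -/
theorem boson_relation (t : F) (s : Site) :
    ann t s * cre s - t • (cre s * ann t s) = (1 - t) • (1 : Module.End F (Space F)) := by
  refine LinearMap.ext fun f => ?_
  funext m
  by_cases h : m s = 0
  · simp [ann, cre, h]
  · have hle : Finsupp.single s 1 ≤ m :=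
      Finsupp.single_le_iff.2 (Nat.one_le_iff_ne_zero.2 h)
    have h1 : m s - 1 + 1 = m s := by omega
    simp [ann, cre, h, tsub_add_cancel_of_le hle, h1]
    ring

/-! ### `L` and `B` matrices

Matrices over the two-dimensional auxiliary space.  The row index is the state of the left edge of
a tile and the column index that of its right edge; index `0` is a hole, index `1` a particle. -/

noncomputable def Lmat (t x : F) (s : Site) :
    Matrix (Fin 2) (Fin 2) (Module.End F (Space F)) :=
  !![x • 1, x • cre s;
     ann t s, 1]

noncomputable def Bmat (t c x : F) (s : Site) :
    Matrix (Fin 2) (Fin 2) (Module.End F (Space F)) :=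
  !![tnum t s, (c * x) • (cre s * tnum t s);
     ann t s, 1 - (c * x) • tnum t s]

/-- One row of the lattice, on the boundary sites and the bulk sites `0, …, N - 1`:
`B^γ(x, φ₋₂) B^δ(x, φ₋₁) L(x, φ₀) ⋯ L(x, φ_{N-1})`. -/
noncomputable def row (t γ δ x : F) (N : ℕ) :
    Matrix (Fin 2) (Fin 2) (Module.End F (Space F)) :=
  Bmat t γ x (Sum.inl 0) * Bmat t δ x (Sum.inl 1) *
    ((List.range N).map fun i => Lmat t x (Sum.inr i)).prod

/-- The boundary covector `⟨K|`: the entry in row `i`, column `j` is its value on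
`eᵢ ⊗ eⱼ ∈ W_a ⊗ W_ā`. -/
def Kcov (t : F) : Matrix (Fin 2) (Fin 2) F :=
  !![0, 1;
     -t, 0]

/-- The component `--` (a particle at the right end of both rows) of the double-row transfer matrix
on the lattice truncated to the bulk sites `0, …, N - 1`.  The row `a` carries the parameter `x`
and acts first; the row `ā` carries `x⁻¹` and acts second; `⟨K|` joins their left ends.
(Operators at different sites commute, so that the boundary operators of row `a` may stand to the
right of the bulk operators of row `ā`.) -/
noncomputable def doubleRowTrunc (t γ δ x : F) (N : ℕ) : Module.End F (Space F) :=
  ∑ i : Fin 2, ∑ j : Fin 2, Kcov t i j • (row t γ δ x⁻¹ N j 1 * row t γ δ x N i 1)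

/-- The number of bulk sites of the smallest initial segment that holds all bulk particles of `m`. -/
def cutoff (m : State) : ℕ := m.support.sup (Sum.elim (fun _ => 0) Nat.succ)

/-- The double-row transfer matrix `𝕋₋₋(x; γ, δ)` on the infinite lattice.  Its coefficient at a
state `m` only involves tiles with particles on both horizontal edges, of weight `1`, beyond the
last bulk particle of `m`; see `doubleRow_apply`. -/
noncomputable def doubleRow (t γ δ x : F) : Module.End F (Space F) where
  toFun f := fun m => doubleRowTrunc t γ δ x (cutoff m) f m
  map_add' f g := by funext m; simp
  map_smul' c f := by funext m; simp

/-- The operators that preserve the combinations of states with site `s` occupied. -/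
def preserving (F : Type*) [Field F] (s : Site) : Subring (Module.End F (Space F)) where
  carrier := {A | ∀ f : Space F, (∀ m : State, m s = 0 → f m = 0) →
    ∀ m : State, m s = 0 → A f m = 0}
  mul_mem' hA hB f hf := hA _ (hB f hf)
  one_mem' _ hf := hf
  add_mem' hA hB f hf m hm := by simp [hA f hf m hm, hB f hf m hm]
  zero_mem' _ _ _ _ := rfl
  neg_mem' hA f hf m hm := by simp [hA f hf m hm]

theorem smul_mem_preserving (s : Site) (c : F) {A : Module.End F (Space F)}
    (hA : A ∈ preserving F s) : c • A ∈ preserving F s := by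
  intro f hf m hm
  simp [hA f hf m hm]

theorem ann_mem_preserving (t : F) {s r : Site} (h : r ≠ s) : ann t r ∈ preserving F s := by
  intro f hf m hm
  have : (m + Finsupp.single r 1 : State) s = 0 := by simp [hm, h]
  simp [ann, hf _ this]

theorem cre_mem_preserving (s r : Site) :
    (cre r : Module.End F (Space F)) ∈ preserving F s := by
  intro f hf m hm
  have : (m - Finsupp.single r 1 : State) s = 0 := by simp [hm]
  simp [cre, hf _ this]

theorem tnum_mem_preserving (t : F) (s r : Site) : tnum t r ∈ preserving F s := by
  intro f hf m hm
  simp [tnum, hf m hm]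

theorem mul_entries_mem {R : Type*} [Ring R] (S : Subring R) {A B : Matrix (Fin 2) (Fin 2) R}
    (hA : ∀ i j, A i j ∈ S) (hB : ∀ i j, B i j ∈ S) (i j : Fin 2) : (A * B) i j ∈ S := by
  rw [Matrix.mul_apply]
  exact S.sum_mem fun k _ => S.mul_mem (hA i k) (hB k j)

theorem Lmat_mem_preserving (t x : F) {s r : Site} (h : r ≠ s) (i j : Fin 2) :
    Lmat t x r i j ∈ preserving F s := by
  fin_cases i <;> fin_cases j
  · exact smul_mem_preserving s x (one_mem _)
  · exact smul_mem_preserving s x (cre_mem_preserving s r)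
  · exact ann_mem_preserving t h
  · exact one_mem _

theorem Bmat_mem_preserving (t c x : F) {s r : Site} (h : r ≠ s) (i j : Fin 2) :
    Bmat t c x r i j ∈ preserving F s := by
  fin_cases i <;> fin_cases j
  · exact tnum_mem_preserving t s r
  · exact smul_mem_preserving s _ (mul_mem (cre_mem_preserving s r) (tnum_mem_preserving t s r))
  · exact ann_mem_preserving t h
  · exact sub_mem (one_mem _) (smul_mem_preserving s _ (tnum_mem_preserving t s r))

theorem row_succ (t γ δ x : F) (N : ℕ) :
    row t γ δ x (N + 1) = row t γ δ x N * Lmat t x (Sum.inr N) := by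
  simp [row, List.range_succ, mul_assoc]

theorem row_mem_preserving (t γ δ x : F) {N M : ℕ} (h : N ≤ M) (i j : Fin 2) :
    row t γ δ x N i j ∈ preserving F (Sum.inr M) := by
  induction N generalizing i j with
  | zero =>
    have : row t γ δ x 0 = Bmat t γ x (Sum.inl 0) * Bmat t δ x (Sum.inl 1) := by simp [row]
    rw [this]
    exact mul_entries_mem _ (Bmat_mem_preserving t γ x (by simp))
      (Bmat_mem_preserving t δ x (by simp)) i j
  | succ k ih =>
    rw [row_succ]
    exact mul_entries_mem _ (fun i j => ih (by omega) i j)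
      (Lmat_mem_preserving t x (by simp; omega)) i j

theorem row_succ_sub (t γ δ x : F) (N : ℕ) (i : Fin 2) (f : Space F) (m : State)
    (hm : m (Sum.inr N) = 0) :
    row t γ δ x (N + 1) i 1 f m = row t γ δ x N i 1 f m := by
  have h : row t γ δ x (N + 1) i 1 =
      row t γ δ x N i 0 * (x • cre (Sum.inr N)) + row t γ δ x N i 1 := by
    rw [row_succ, Matrix.mul_apply, Fin.sum_univ_two]
    simp [Lmat]
  rw [h, LinearMap.add_apply, Pi.add_apply, Module.End.mul_apply,
    row_mem_preserving t γ δ x le_rfl i 0 _ _ m hm, zero_add]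
  intro k hk
  simp [cre, hk]

theorem doubleRowTrunc_succ (t γ δ x : F) (N : ℕ) (f : Space F) (m : State)
    (hm : m (Sum.inr N) = 0) :
    doubleRowTrunc t γ δ x (N + 1) f m = doubleRowTrunc t γ δ x N f m := by
  have key : ∀ i j : Fin 2,
      (row t γ δ x⁻¹ (N + 1) j 1 * row t γ δ x (N + 1) i 1) f m =
        (row t γ δ x⁻¹ N j 1 * row t γ δ x N i 1) f m := by
    intro i j
    rw [Module.End.mul_apply, Module.End.mul_apply, row_succ_sub _ _ _ _ _ _ _ _ hm, ← sub_eq_zero,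
      ← Pi.sub_apply, ← map_sub]
    refine row_mem_preserving t γ δ x⁻¹ le_rfl j 1 _ ?_ m hm
    intro k hk
    rw [Pi.sub_apply, row_succ_sub _ _ _ _ _ _ _ _ hk, sub_self]
  simp only [doubleRowTrunc, LinearMap.sum_apply, Finset.sum_apply, LinearMap.smul_apply,
    Pi.smul_apply, key]

theorem eq_zero_of_cutoff_le {m : State} {N : ℕ} (h : cutoff m ≤ N) : m (Sum.inr N) = 0 := by
  by_contra h0
  have h1 : Sum.elim (fun _ => 0) Nat.succ (Sum.inr N : Site) ≤ cutoff m :=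
    Finset.le_sup (f := Sum.elim (fun _ => 0) Nat.succ) (Finsupp.mem_support_iff.2 h0)
  simp at h1
  omega

/-- Every sufficiently long truncation of the lattice gives the same coefficient. -/
theorem doubleRow_apply (t γ δ x : F) (f : Space F) (m : State) {N : ℕ} (h : cutoff m ≤ N) :
    doubleRow t γ δ x f m = doubleRowTrunc t γ δ x N f m := by
  induction N, h using Nat.le_induction with
  | base => rfl
  | succ k hk ih => rw [ih, doubleRowTrunc_succ _ _ _ _ _ _ _ (eq_zero_of_cutoff_le hk)]

/-! ### The `BCₙ` Hall–Littlewood polynomial -/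

/-- The state `|0̂⟩ ⊗ |λ⟩`: bulk site `i` holds `mᵢ(λ)` particles, for all `i ≥ 0` (parts equal to
zero are counted), and the boundary sites are empty. -/
noncomputable def partState {n : ℕ} (lam : Fin n → ℕ) : State :=
  ∑ i, Finsupp.single (Sum.inr (lam i)) 1

theorem partState_inr {n : ℕ} (lam : Fin n → ℕ) (k : ℕ) :
    partState lam (Sum.inr k) = (Finset.univ.filter fun i => lam i = k).card := by
  rw [Finset.card_filter]
  simp only [partState, Finsupp.finsetSum_apply, Finsupp.single_apply, Sum.inr.injEq]

theorem partState_inl {n : ℕ} (lam : Fin n → ℕ) (k : Fin 2) :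
    partState lam (Sum.inl k) = 0 := by
  simp [partState, Finsupp.finsetSum_apply]

/-- The matrix element `⟨0̂| ⊗ ⟨λ| 𝕋₋₋(xₙ; γ, δ) ⋯ 𝕋₋₋(x₁; γ, δ) |0̂⟩ ⊗ |0⟩`. -/
noncomputable def latticeSum {n : ℕ} (lam : Fin n → ℕ) (t γ δ : F) (x : Fin n → F) : F :=
  ((List.ofFn fun i => doubleRow t γ δ (x i)).reverse.prod (ket F 0)) (partState lam)

/-- `K_λ(x₁^{±1}, …, xₙ^{±1}; t; γ, δ)`, defined by
`∏ᵢ (xᵢ - t xᵢ⁻¹) · K_λ = ⟨0̂| ⊗ ⟨λ| 𝕋₋₋(xₙ; γ, δ) ⋯ 𝕋₋₋(x₁; γ, δ) |0̂⟩ ⊗ |0⟩`. -/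
noncomputable def hallLittlewoodK {n : ℕ} (lam : Fin n → ℕ) (t γ δ : F) (x : Fin n → F) : F :=
  latticeSum lam t γ δ x / ∏ i, (x i - t * (x i)⁻¹)

/-! ### The sum over signed permutations -/

/-- The subgroup `Sₙ^λ` of `Sₙ` that stabilizes `λ`. -/
def stab {n : ℕ} (lam : Fin n → ℕ) : Subgroup (Equiv.Perm (Fin n)) where
  carrier := {σ | ∀ i, lam (σ i) = lam i}
  mul_mem' ha hb i := by rw [Equiv.Perm.mul_apply, ha, hb]
  one_mem' _ := rfl
  inv_mem' {a} ha i := by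
    have h : a (a⁻¹ i) = i := a.apply_symm_apply i
    rw [← ha (a⁻¹ i), h]

instance {n : ℕ} (lam : Fin n → ℕ) : DecidablePred (· ∈ stab lam) :=
  fun σ => inferInstanceAs (Decidable (∀ i, lam (σ i) = lam i))

/-- The function of `x₁, …, xₙ` that is symmetrized. -/
def summand {n : ℕ} (lam : Fin n → ℕ) (t γ δ : F) (x : Fin n → F) : F :=
  (∏ i, x i ^ lam i * ((1 - γ * (x i)⁻¹) * (1 - δ * (x i)⁻¹) / (1 - (x i)⁻¹ ^ 2))) *
  (∏ p : Fin n × Fin n with lam p.1 > lam p.2, (x p.1 - t * x p.2) / (x p.1 - x p.2)) *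
  ∏ p : Fin n × Fin n with p.1 < p.2,
    (1 - t * (x p.1)⁻¹ * (x p.2)⁻¹) / (1 - (x p.1)⁻¹ * (x p.2)⁻¹)

theorem prod_lt_comp {n : ℕ} (h : Fin n → Fin n → F) (hs : ∀ i j, h i j = h j i)
    (τ : Equiv.Perm (Fin n)) :
    (∏ p : Fin n × Fin n with p.1 < p.2, h (τ p.1) (τ p.2)) =
      ∏ p : Fin n × Fin n with p.1 < p.2, h p.1 p.2 := by
  refine Finset.prod_bij'
    (fun p _ => if τ p.1 < τ p.2 then (τ p.1, τ p.2) else (τ p.2, τ p.1))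
    (fun p _ => if τ⁻¹ p.1 < τ⁻¹ p.2 then (τ⁻¹ p.1, τ⁻¹ p.2) else (τ⁻¹ p.2, τ⁻¹ p.1))
    ?_ ?_ ?_ ?_ ?_
  · rintro ⟨i, j⟩ hp
    simp only [Finset.mem_filter, Finset.mem_univ, true_and] at hp ⊢
    have : τ i ≠ τ j := fun e => hp.ne (τ.injective e)
    split_ifs with h1
    · exact h1
    · exact lt_of_le_of_ne (not_lt.1 h1) this.symm
  · rintro ⟨i, j⟩ hp
    simp only [Finset.mem_filter, Finset.mem_univ, true_and] at hp ⊢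
    have : τ⁻¹ i ≠ τ⁻¹ j := fun e => hp.ne (τ⁻¹.injective e)
    split_ifs with h1
    · exact h1
    · exact lt_of_le_of_ne (not_lt.1 h1) this.symm
  · rintro ⟨i, j⟩ hp
    simp only [Finset.mem_filter, Finset.mem_univ, true_and] at hp
    dsimp only
    split_ifs with h1 h2 h2 <;> simp_all [not_lt.2 hp.le]
  · rintro ⟨i, j⟩ hp
    simp only [Finset.mem_filter, Finset.mem_univ, true_and] at hp
    dsimp only
    split_ifs with h1 h2 h2 <;> simp_all [not_lt.2 hp.le]
  · rintro ⟨i, j⟩ _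
    dsimp only
    split_ifs
    · rfl
    · exact hs _ _

theorem summand_comp {n : ℕ} (lam : Fin n → ℕ) (t γ δ : F) (x : Fin n → F)
    {τ : Equiv.Perm (Fin n)} (hτ : τ ∈ stab lam) :
    summand lam t γ δ (fun i => x (τ i)) = summand lam t γ δ x := by
  have hτ' : ∀ i, lam (τ i) = lam i := hτ
  unfold summand
  congr 1
  · congr 1
    · rw [← Equiv.prod_comp τ fun i =>
        x i ^ lam i * ((1 - γ * (x i)⁻¹) * (1 - δ * (x i)⁻¹) / (1 - (x i)⁻¹ ^ 2))]
      simp only [hτ']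
    · rw [Finset.prod_filter, Finset.prod_filter,
        ← Equiv.prod_comp (τ.prodCongr τ) fun p : Fin n × Fin n =>
          if lam p.1 > lam p.2 then (x p.1 - t * x p.2) / (x p.1 - x p.2) else 1]
      simp [hτ']
  · exact prod_lt_comp (fun i j => (1 - t * (x i)⁻¹ * (x j)⁻¹) / (1 - (x i)⁻¹ * (x j)⁻¹))
      (fun i j => by ring) τ

/-- The signed permutations `(Sₙ / Sₙ^λ) ⋉ {±1}ⁿ`, as pairs of a left coset and a vector of signs. -/
abbrev SignedCosets {n : ℕ} (lam : Fin n → ℕ) : Type :=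
  (Equiv.Perm (Fin n) ⧸ stab lam) × (Fin n → ℤˣ)

/-- The image of the summand under the signed permutation `ω = (σ Sₙ^λ, ε)`, which replaces `xᵢ` by
`x_{σ(i)} ^ ε_{σ(i)}`.  By `summand_comp` it does not depend on the representative `σ`. -/
def signedTerm {n : ℕ} (lam : Fin n → ℕ) (t γ δ : F) (x : Fin n → F) (ω : SignedCosets lam) : F :=
  Quotient.liftOn' ω.1
    (fun σ => summand lam t γ δ fun i => x (σ i) ^ (ω.2 (σ i) : ℤ))
    (by
      intro σ ρ h
      have hτ : σ⁻¹ * ρ ∈ stab lam := QuotientGroup.leftRel_apply.1 h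
      have := summand_comp lam t γ δ (fun i => x (σ i) ^ (ω.2 (σ i) : ℤ)) hτ
      simpa using this.symm)

end BCHL

/-! The proof is an algebraic Bethe ansatz with a reflecting end. Let `C = R₀₁` and `D = R₁₁` be the
entries of the last column of a single row. They satisfy the Yang–Baxter exchange relations, because
these hold for the empty row and survive the addition of an `L` or `B` tile on the left
(`left_mul_L`, `left_mul_B`). The vacuum is an eigenvector of `D(u)` with eigenvalue `d(u) = (1 -
γu)(1 - δu)`.

One exchange turns the double-row operator into `(x - t x⁻¹)/(x - x⁻¹)` times `C(x) D(x⁻¹) - C(x⁻¹)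
D(x)` (`doubleOp_eq`). When `D` is moved through a product of `C`'s to the vacuum, the result is a
wanted term plus unwanted terms in which `D` has traded its parameter with some `C` (`D_bethe`). In
the sum over all inversions of the variables, the unwanted terms cancel in pairs differing in the
sign of one variable (`boundary_unwanted`). What remains is a sum over sign choices `y` of Bethe
vectors `∏ C(yᵢ)|0⟩`, with coefficient `± ∏ d(yᵢ⁻¹)` times a product of two-body factors
(`prod_doubleOp`). This accounts for the group `{±1}ⁿ`, the boundary factors and the product over `i
< j`.

It remains to pair a Bethe vector with `⟨λ|`. Boundary tiles do not affect the coefficient at a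
state with empty boundary sites (`bethe_row_apply`). In the bulk, sites are removed from the left
one at a time (`bethe_coproduct`): each site splits the variables into those that leave a particle
there and those that move on, and the interaction of the two groups is the Hall–Littlewood factor.
This yields the sum over `Sₙ/Sₙ^λ` (`bethe_monodromy`), and `signedTerm_eq` matches the two
descriptions term by term. -/

namespace BCHL

variable {F : Type*} [Field F]

/-! ### Exchange relations and their stability under adding a tile -/

/-- The relations between the two entries `C = R₀₁` and `D = R₁₁` of the last column of a
monodromy matrix that follow from the Yang–Baxter equation. -/
structure ExchangeAlgebra (t : F) {E : Type*} [Ring E] [Algebra F E] (C D : F → E) : Prop where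
  comm_C : ∀ u v, C u * C v = C v * C u
  comm_D : ∀ u v, D u * D v = D v * D u
  exch : ∀ u v, (v - u) • (D u * C v) =
    (v - t * u) • (C v * D u) - ((1 - t) * v) • (C u * D v)

/-- The coefficient of the wanted term in the exchange relation. -/
def fcoef (t u v : F) : F := (v - t * u) / (v - u)

/-- The coefficient of the unwanted term in the exchange relation. -/
def gcoef (t u v : F) : F := -((1 - t) * v) / (v - u)

/-- Commutation at equal parameters is trivial, so the closure proofs may divide by `u - v`. -/
theorem mul_comm_of_ne {ι E : Type*} [Mul E] {X : ι → E} (h : ∀ u v, u ≠ v → X u * X v = X v * X u) (u v : ι) :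
    X u * X v = X v * X u := by
  by_cases huv : u = v
  · rw [huv]
  · exact h u v huv

namespace ExchangeAlgebra

section Closure

variable {t : F} {E : Type*} [Ring E] [Algebra F E] {C D : F → E}

theorem D_mul_C (h : ExchangeAlgebra t C D) {u v : F} (huv : u ≠ v) :
    D u * C v = fcoef t u v • (C v * D u) + gcoef t u v • (C u * D v) := by
  have h1 : v - u ≠ 0 := sub_ne_zero.2 huv.symm
  have h2 := congrArg (fun z => (v - u)⁻¹ • z) (h.exch u v)
  simp only [smul_smul, inv_mul_cancel₀ h1, one_smul, smul_sub] at h2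
  rw [h2, fcoef, gcoef]
  match_scalars <;> ring

theorem base (t : F) : ExchangeAlgebra t (fun _ => (0 : E)) (fun _ => 1) where
  comm_C _ _ := rfl
  comm_D _ _ := rfl
  exch _ _ := by simp

variable {a c q : E}

/-- Normal ordering: site operators move to the left of `C` and `D`, with `c` before `a`, and every
`D C` is exchanged into `C D`. Each relation then becomes an identity of rational functions in the
coefficients of the ordered words. -/
theorem left_mul_L (h : ExchangeAlgebra t C D)
    (hac : a * c = (1 - t) • 1 + t • (c * a))
    (haC : ∀ u, C u * a = a * C u) (haD : ∀ u, D u * a = a * D u)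
    (hcC : ∀ u, C u * c = c * C u) (hcD : ∀ u, D u * c = c * D u) :
    ExchangeAlgebra t (fun u => u • C u + u • (c * D u)) (fun u => a * C u + D u) := by
  have hac' : ∀ z, a * (c * z) = (1 - t) • z + t • (c * (a * z)) := fun z => by
    rw [← mul_assoc, hac]; simp [add_mul, mul_assoc]
  have haC' : ∀ u z, C u * (a * z) = a * (C u * z) := fun u z => by
    rw [← mul_assoc, haC, mul_assoc]
  have haD' : ∀ u z, D u * (a * z) = a * (D u * z) := fun u z => by
    rw [← mul_assoc, haD, mul_assoc]
  have hcC' : ∀ u z, C u * (c * z) = c * (C u * z) := fun u z => by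
    rw [← mul_assoc, hcC, mul_assoc]
  have hcD' : ∀ u z, D u * (c * z) = c * (D u * z) := fun u z => by
    rw [← mul_assoc, hcD, mul_assoc]
  refine ⟨mul_comm_of_ne fun u v huv => ?_, mul_comm_of_ne fun u v huv => ?_, fun u v => ?_⟩
  · have h1 : v - u ≠ 0 := sub_ne_zero.2 huv.symm
    have h2 : u - v ≠ 0 := sub_ne_zero.2 huv
    simp only [mul_add, add_mul, smul_add, smul_mul_assoc, mul_smul_comm, mul_assoc, hcC', hcD',
      h.D_mul_C huv, h.D_mul_C huv.symm, h.comm_C v u, h.comm_D v u, fcoef, gcoef]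
    match_scalars <;> field_simp <;> ring
  · have h1 : v - u ≠ 0 := sub_ne_zero.2 huv.symm
    have h2 : u - v ≠ 0 := sub_ne_zero.2 huv
    simp only [mul_add, add_mul, mul_smul_comm, mul_assoc, haC', haD',
      h.D_mul_C huv, h.D_mul_C huv.symm, h.comm_C v u, h.comm_D v u, fcoef, gcoef]
    match_scalars <;> field_simp <;> ring
  · by_cases huv : u = v
    · subst huv
      simp only [sub_self, zero_smul]
      module
    have h1 : v - u ≠ 0 := sub_ne_zero.2 (Ne.symm huv)
    have h2 : u - v ≠ 0 := sub_ne_zero.2 huv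
    simp only [mul_add, add_mul, smul_add, smul_mul_assoc, mul_smul_comm, mul_assoc, haC', haD',
      hcC', hcD', hac', h.D_mul_C huv, h.D_mul_C (Ne.symm huv),
      h.comm_C v u, h.comm_D v u, fcoef, gcoef]
    match_scalars <;> field_simp <;> ring

theorem left_mul_B (h : ExchangeAlgebra t C D) (r : F)
    (hac : a * c = 1 - t • q) (hca : c * a = 1 - q)
    (hqc : q * c = t • (c * q)) (haq : a * q = t • (q * a))
    (haC : ∀ u, C u * a = a * C u) (haD : ∀ u, D u * a = a * D u)
    (hcC : ∀ u, C u * c = c * C u) (hcD : ∀ u, D u * c = c * D u)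
    (hqC : ∀ u, C u * q = q * C u) (hqD : ∀ u, D u * q = q * D u) :
    ExchangeAlgebra t (fun u => q * C u + (r * u) • (c * q * D u))
      (fun u => a * C u + (1 - (r * u) • q) * D u) := by
  have hac' : ∀ z, a * (c * z) = z - t • (q * z) := fun z => by
    rw [← mul_assoc, hac]; simp [sub_mul]
  have hca' : ∀ z, c * (a * z) = z - q * z := fun z => by rw [← mul_assoc, hca, sub_mul, one_mul]
  have hqc' : ∀ z, q * (c * z) = t • (c * (q * z)) := fun z => by
    rw [← mul_assoc, hqc]; simp [mul_assoc]
  have haq' : ∀ z, a * (q * z) = t • (q * (a * z)) := fun z => by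
    rw [← mul_assoc, haq]; simp [mul_assoc]
  -- The words `q²`, `q` and `c q a` are linearly dependent: multiply `c a = 1 - q` by `q` on the
  -- left and move `q` past `c`. Eliminating `q²` makes the comparison of coefficients in the
  -- exchange relation possible.
  have hqq' : ∀ z, q * (q * z) = q * z - t • (c * (q * (a * z))) := fun z => by
    have : q * (c * (a * z)) = q * z - q * (q * z) := by rw [hca', mul_sub]
    rw [← hqc', this, sub_sub_cancel]
  have haC' : ∀ u z, C u * (a * z) = a * (C u * z) := fun u z => by
    rw [← mul_assoc, haC, mul_assoc]
  have haD' : ∀ u z, D u * (a * z) = a * (D u * z) := fun u z => by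
    rw [← mul_assoc, haD, mul_assoc]
  have hcC' : ∀ u z, C u * (c * z) = c * (C u * z) := fun u z => by
    rw [← mul_assoc, hcC, mul_assoc]
  have hcD' : ∀ u z, D u * (c * z) = c * (D u * z) := fun u z => by
    rw [← mul_assoc, hcD, mul_assoc]
  have hqC' : ∀ u z, C u * (q * z) = q * (C u * z) := fun u z => by
    rw [← mul_assoc, hqC, mul_assoc]
  have hqD' : ∀ u z, D u * (q * z) = q * (D u * z) := fun u z => by
    rw [← mul_assoc, hqD, mul_assoc]
  refine ⟨mul_comm_of_ne fun u v huv => ?_, mul_comm_of_ne fun u v huv => ?_, fun u v => ?_⟩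
  · have h1 : v - u ≠ 0 := sub_ne_zero.2 huv.symm
    have h2 : u - v ≠ 0 := sub_ne_zero.2 huv
    simp only [mul_add, add_mul, smul_add, smul_mul_assoc, mul_smul_comm, mul_assoc, hcC', hcD',
      hqC', hqD', hqc', h.D_mul_C huv, h.D_mul_C huv.symm, h.comm_C v u,
      h.comm_D v u, fcoef, gcoef]
    match_scalars <;> field_simp <;> ring
  · have h1 : v - u ≠ 0 := sub_ne_zero.2 huv.symm
    have h2 : u - v ≠ 0 := sub_ne_zero.2 huv
    simp only [mul_add, add_mul, mul_sub, sub_mul, one_mul, smul_sub, smul_add, smul_mul_assoc,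
      mul_smul_comm, mul_assoc, haC', haD', hqC', hqD', haq',
      h.D_mul_C huv, h.D_mul_C huv.symm, h.comm_C v u, h.comm_D v u, fcoef, gcoef]
    match_scalars <;> field_simp <;> ring
  · by_cases huv : u = v
    · subst huv
      simp only [sub_self, zero_smul]
      module
    have h1 : v - u ≠ 0 := sub_ne_zero.2 (Ne.symm huv)
    have h2 : u - v ≠ 0 := sub_ne_zero.2 huv
    simp only [mul_add, add_mul, mul_sub, sub_mul, one_mul, smul_sub, smul_add, smul_mul_assoc,
      mul_smul_comm, mul_assoc, haC', haD',
      hcC', hcD', hqC', hqD', hac', hqc', haq',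
      hqq', h.D_mul_C huv, h.D_mul_C (Ne.symm huv),
      h.comm_C v u, h.comm_D v u, fcoef, gcoef]
    match_scalars <;> field_simp <;> ring

end Closure

end ExchangeAlgebra

/-! ### Bethe vectors and the off-shell action of `D` -/

/-- The Bethe vector `∏_{i ∈ S} C(yᵢ) v₀`. -/
noncomputable def bethe {V ι : Type*} [AddCommGroup V] [Module F V] (C : F → Module.End F V)
    (y : ι → F) (v₀ : V) (S : Finset ι) : V :=
  (S.toList.map fun i => C (y i)).prod v₀

section Bethe

variable {V ι : Type*} [AddCommGroup V] [Module F V] [DecidableEq ι]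
variable {t : F} {C D : F → Module.End F V} {y : ι → F} {v₀ : V}

omit [DecidableEq ι] in
@[simp] theorem bethe_empty : bethe C y v₀ ∅ = v₀ := by simp [bethe]

omit [DecidableEq ι] in
theorem bethe_congr {y' : ι → F} {S : Finset ι} (h : ∀ i ∈ S, y i = y' i) :
    bethe C y v₀ S = bethe C y' v₀ S := by
  unfold bethe
  congr 2
  exact List.map_congr_left fun i hi => by rw [h i (Finset.mem_toList.1 hi)]

theorem bethe_insert (hC : ∀ u v, C u * C v = C v * C u) {S : Finset ι} {a : ι} (ha : a ∉ S) :
    bethe C y v₀ (insert a S) = C (y a) (bethe C y v₀ S) := by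
  have h : (((insert a S).toList.map fun i => C (y i)).prod : Module.End F V) =
      ((a :: S.toList).map fun i => C (y i)).prod := by
    refine ((Finset.toList_insert ha).map _).prod_eq' ?_
    refine List.pairwise_of_forall_mem_list fun p hp q hq => ?_
    obtain ⟨i, -, rfl⟩ := List.mem_map.1 hp
    obtain ⟨j, -, rfl⟩ := List.mem_map.1 hq
    exact hC _ _
  rw [bethe, h, List.map_cons, List.prod_cons]
  rfl

theorem bethe_erase (hC : ∀ u v, C u * C v = C v * C u) {S : Finset ι} {a : ι} (ha : a ∈ S) :
    bethe C y v₀ S = C (y a) (bethe C y v₀ (S.erase a)) := by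
  rw [← bethe_insert hC (Finset.notMem_erase a S), Finset.insert_erase ha]

/-- Consistency of two ways to reach `C(u) C(z) D(w)` from `D(u) C(z) C(w)`. On the left, `D` meets
`z` first, either passing it or trading parameters, and then trades with `w`. On the right, it
trades with `w` first and then passes `z`. -/
theorem fcoef_gcoef (t : F) {u w z : F} (huz : u ≠ z) (huw : u ≠ w) (hzw : z ≠ w) :
    fcoef t u z * gcoef t u w + gcoef t u z * gcoef t z w = gcoef t u w * fcoef t w z := by
  have h1 := sub_ne_zero.2 huz.symm
  have h2 := sub_ne_zero.2 huw.symm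
  have h3 := sub_ne_zero.2 hzw.symm
  have h4 := sub_ne_zero.2 hzw
  unfold fcoef gcoef
  field_simp
  ring

/-- The off-shell action of `D` on a Bethe vector. -/
theorem ExchangeAlgebra.D_bethe (h : ExchangeAlgebra t C D) {d : F → F}
    (hd : ∀ u, D u v₀ = d u • v₀) {S : Finset ι} (hy : Set.InjOn y S) {u : F}
    (hu : ∀ i ∈ S, u ≠ y i) :
    D u (bethe C y v₀ S) = (d u * ∏ j ∈ S, fcoef t u (y j)) • bethe C y v₀ S +
      ∑ k ∈ S, (gcoef t u (y k) * d (y k) * ∏ j ∈ S.erase k, fcoef t (y k) (y j)) •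
        C u (bethe C y v₀ (S.erase k)) := by
  induction S using Finset.induction_on generalizing u with
  | empty => simp [hd]
  | insert z S hz ih =>
    have hyS : Set.InjOn y S := hy.mono (by simp)
    have huS : ∀ i ∈ S, u ≠ y i := fun i hi => hu i (Finset.mem_insert_of_mem hi)
    have huz : u ≠ y z := hu z (Finset.mem_insert_self _ _)
    have hzS : ∀ i ∈ S, y z ≠ y i := fun i hi e =>
      hz (hy (Finset.mem_insert_self _ _) (Finset.mem_insert_of_mem hi) e ▸ hi)
    have hCC : ∀ a b w, C a (C b w) = C b (C a w) := fun a b w =>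
      LinearMap.congr_fun (h.comm_C a b) w
    have hDC := LinearMap.congr_fun (h.D_mul_C huz) (bethe C y v₀ S)
    simp only [Module.End.mul_apply, LinearMap.add_apply, LinearMap.smul_apply] at hDC
    rw [bethe_insert h.comm_C hz, hDC, ih hyS huS, ih hyS hzS, Finset.prod_insert hz,
      Finset.sum_insert hz, Finset.erase_insert hz]
    -- An unwanted term for `k ∈ S` arises twice in the induction, from `D(u)` and from `D(y z)`
    -- acting on the smaller vector; `fcoef_gcoef` adds the two contributions.
    have hk : ∀ k ∈ S, (gcoef t u (y k) * d (y k) *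
          ∏ j ∈ (insert z S).erase k, fcoef t (y k) (y j)) •
          C u (bethe C y v₀ ((insert z S).erase k)) =
        fcoef t u (y z) • (gcoef t u (y k) * d (y k) *
          ∏ j ∈ S.erase k, fcoef t (y k) (y j)) • C (y z) (C u (bethe C y v₀ (S.erase k))) +
        gcoef t u (y z) • (gcoef t (y z) (y k) * d (y k) *
          ∏ j ∈ S.erase k, fcoef t (y k) (y j)) • C u (C (y z) (bethe C y v₀ (S.erase k))) := by
      intro k hk
      have hne : z ≠ k := fun e => hz (e ▸ hk)
      have hz' : z ∉ S.erase k := fun e => hz (Finset.mem_of_mem_erase e)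
      rw [Finset.erase_insert_of_ne hne, Finset.prod_insert hz', bethe_insert h.comm_C hz',
        hCC u (y z), smul_smul, smul_smul, ← add_smul]
      congr 1
      linear_combination (-(d (y k) * ∏ j ∈ S.erase k, fcoef t (y k) (y j))) *
        fcoef_gcoef t huz (huS k hk) (hzS k hk)
    rw [Finset.sum_congr rfl hk, Finset.sum_add_distrib, ← Finset.smul_sum, ← Finset.smul_sum]
    simp only [map_add, map_smul, map_sum]
    module

end Bethe

/-! ### Expansion of the double-row product over sign choices -/

/-- The variables with those in `A` inverted. -/
def invOn {ι : Type*} [DecidableEq ι] (x : ι → F) (A : Finset ι) (i : ι) : F :=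
  if i ∈ A then (x i)⁻¹ else x i

/-- The two-body factor of the expansion of the boundary Bethe vector. -/
def pairFactor (t y z : F) : F := (1 - t * y⁻¹ * z⁻¹) / (1 - y⁻¹ * z⁻¹)

theorem pairFactor_comm (t y z : F) : pairFactor t y z = pairFactor t z y := by
  unfold pairFactor; ring

/-- This is where the two-body factor comes from: it is the price of moving `D(y⁻¹)` past `C(z)`. -/
theorem fcoef_inv (t : F) {y z : F} (hz : z ≠ 0) : fcoef t y⁻¹ z = pairFactor t y z := by
  unfold fcoef pairFactor
  rw [← mul_div_mul_left _ _ (inv_ne_zero hz)]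
  congr 1 <;> field_simp

theorem fcoef_eq_pairFactor (t : F) {y z : F} (hz : z ≠ 0) :
    fcoef t y z = pairFactor t y⁻¹ z := by
  rw [← fcoef_inv t hz, inv_inv]

section

variable {ι : Type*} [LinearOrder ι]

/-- The order on `ι` only serves to count each unordered pair once; `pairFactor` is symmetric. -/
def pairProd (t : F) (y : ι → F) (S : Finset ι) : F :=
  ∏ i ∈ S, ∏ j ∈ S with j < i, pairFactor t (y i) (y j)

theorem pairProd_insert (t : F) (y : ι → F) {S : Finset ι} {a : ι} (ha : a ∉ S) :
    pairProd t y (insert a S) = (∏ j ∈ S, pairFactor t (y a) (y j)) * pairProd t y S := by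
  simp only [pairProd, Finset.prod_filter, Finset.prod_insert ha, lt_irrefl, if_false, one_mul,
    Finset.prod_mul_distrib]
  rw [← mul_assoc, ← Finset.prod_mul_distrib]
  congr 1
  refine Finset.prod_congr rfl fun j hj => ?_
  have hne : a ≠ j := fun e => ha (e ▸ hj)
  rcases lt_or_gt_of_ne hne with h | h
  · rw [if_neg h.not_gt, if_pos h, one_mul, pairFactor_comm]
  · rw [if_pos h, if_neg h.not_gt, mul_one]

theorem pairProd_congr (t : F) {y y' : ι → F} {S : Finset ι} (h : ∀ i ∈ S, y i = y' i) :
    pairProd t y S = pairProd t y' S := by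
  unfold pairProd
  refine Finset.prod_congr rfl fun i hi => Finset.prod_congr rfl fun j hj => ?_
  rw [h i hi, h j (Finset.mem_filter.1 hj).1]

/-- The coefficient of a Bethe vector in the expansion of the boundary Bethe vector. -/
def boundaryCoef (t : F) (d : F → F) (x : ι → F) (S A : Finset ι) : F :=
  (-1) ^ A.card * (∏ i ∈ S, d (invOn x A i)⁻¹) * pairProd t (invOn x A) S

variable {x : ι → F} {A S : Finset ι} {a : ι}

theorem invOn_of_mem (h : a ∈ A) : invOn x A a = (x a)⁻¹ := if_pos h

theorem invOn_of_notMem (h : a ∉ A) : invOn x A a = x a := if_neg h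

theorem invOn_insert_of_ne {i : ι} (h : i ≠ a) : invOn x (insert a A) i = invOn x A i := by
  simp [invOn, h]

theorem invOn_ne_zero (hx0 : ∀ i, x i ≠ 0) (i : ι) : invOn x A i ≠ 0 := by
  unfold invOn
  split_ifs
  · exact inv_ne_zero (hx0 i)
  · exact hx0 i

theorem ne_invOn (hx0 : ∀ i, x i ≠ 0) (hxx : ∀ i j, i ≠ j → x i ≠ x j)
    (hxx' : ∀ i j, i ≠ j → x i * x j ≠ 1) (i j : ι) (hij : i ≠ j) :
    x i ≠ invOn x A j ∧ (x i)⁻¹ ≠ invOn x A j := by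
  unfold invOn
  have h1 := hxx i j hij
  have h2 := hxx' i j hij
  split_ifs
  · exact ⟨fun e => h2 (by rw [e, inv_mul_cancel₀ (hx0 j)]), fun e => h1 (inv_injective e)⟩
  · exact ⟨h1, fun e => h2 (by rw [← e, mul_inv_cancel₀ (hx0 i)])⟩

theorem invOn_injective (hx0 : ∀ i, x i ≠ 0) (hxx : ∀ i j, i ≠ j → x i ≠ x j)
    (hxx' : ∀ i j, i ≠ j → x i * x j ≠ 1) : Function.Injective (invOn x A) := by
  intro i j e
  by_contra hij
  by_cases hi : i ∈ A
  · exact (ne_invOn hx0 hxx hxx' i j hij).2 (by rw [← e, invOn_of_mem hi])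
  · exact (ne_invOn hx0 hxx hxx' i j hij).1 (by rw [← e, invOn_of_notMem hi])

/-- The new factor is that of the wanted term of `C(x a) D((x a)⁻¹)`. The next lemma does the same
for `-C((x a)⁻¹) D(x a)`, in which the variable of `a` is inverted. -/
theorem boundaryCoef_insert (t : F) (d : F → F) (ha : a ∉ S) (hA : A ⊆ S) :
    boundaryCoef t d x (insert a S) A = boundaryCoef t d x S A *
      (d (x a)⁻¹ * ∏ j ∈ S, pairFactor t (x a) (invOn x A j)) := by
  have haA : a ∉ A := fun h => ha (hA h)
  rw [boundaryCoef, boundaryCoef, Finset.prod_insert ha, pairProd_insert t _ ha,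
    invOn_of_notMem haA]
  ring

theorem boundaryCoef_insert_insert (t : F) (d : F → F) (ha : a ∉ S) (hA : A ⊆ S) :
    boundaryCoef t d x (insert a S) (insert a A) = -(boundaryCoef t d x S A *
      (d (x a) * ∏ j ∈ S, pairFactor t (x a)⁻¹ (invOn x A j))) := by
  have haA : a ∉ A := fun h => ha (hA h)
  have h : ∀ i ∈ S, invOn x (insert a A) i = invOn x A i :=
    fun i hi => invOn_insert_of_ne fun e => ha (e ▸ hi)
  rw [boundaryCoef, boundaryCoef, Finset.prod_insert ha, pairProd_insert t _ ha,
    invOn_of_mem (Finset.mem_insert_self a A), inv_inv, pairProd_congr t h,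
    Finset.card_insert_of_notMem haA, Finset.prod_congr rfl fun i hi =>
      congrArg (fun z => d z⁻¹) (h i hi), Finset.prod_congr rfl fun i hi =>
      congrArg (pairFactor t (x a)⁻¹) (h i hi)]
  ring

/-- The difference `g(x⁻¹, y) - g(x, y)` equals `(1 - t)(x - x⁻¹) / (y + y⁻¹ - x - x⁻¹)`, which is
invariant under `y ↦ y⁻¹`. -/
theorem gcoef_cancel (t : F) {x y : F} (hx : x ≠ 0) (hy : y ≠ 0) (h1 : x ≠ y)
    (h2 : x * y ≠ 1) :
    gcoef t x⁻¹ y - gcoef t x y - (gcoef t x⁻¹ y⁻¹ - gcoef t x y⁻¹) = 0 := by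
  have h3 : y - x ≠ 0 := sub_ne_zero.2 h1.symm
  have h4 : x - y ≠ 0 := sub_ne_zero.2 h1
  have h5 : x * y - 1 ≠ 0 := sub_ne_zero.2 h2
  have h6 : 1 - x * y ≠ 0 := sub_ne_zero.2 h2.symm
  have e1 : gcoef t x⁻¹ y = -((1 - t) * (x * y)) / (x * y - 1) := by
    rw [gcoef, ← mul_div_mul_left _ _ hx]; congr 1 <;> field_simp
  have e2 : gcoef t x⁻¹ y⁻¹ = -((1 - t) * x) / (x - y) := by
    rw [gcoef, ← mul_div_mul_left _ _ (mul_ne_zero hx hy)]; congr 1 <;> field_simp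
  have e3 : gcoef t x y⁻¹ = -(1 - t) / (1 - x * y) := by
    rw [gcoef, ← mul_div_mul_left _ _ hy]; congr 1 <;> field_simp
  rw [e1, e2, e3, gcoef]
  field_simp
  ring

variable {V : Type*} [AddCommGroup V] [Module F V]
variable {t : F} {C D : F → Module.End F V} {v₀ : V}

/-- The expansion of the boundary Bethe vector in Bethe vectors, up to normalization. -/
noncomputable def boundaryBethe (t : F) (d : F → F) (C : F → Module.End F V) (x : ι → F)
    (v₀ : V) (S : Finset ι) : V :=
  ∑ A ∈ S.powerset, boundaryCoef t d x S A • bethe C (invOn x A) v₀ S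

/-- Pair `A` with `insert k A` for `k ∉ A`. The remaining Bethe vector omits `k`, so it is the same
for both. The factors `d` and `pairFactor` at `x k` and at `(x k)⁻¹` both occur in each term, one
set from `boundaryCoef` and one from the action of `D`, so the terms differ only in sign and in
`gcoef`; then `gcoef_cancel` applies. -/
theorem boundary_unwanted (d : F → F) (hx0 : ∀ i, x i ≠ 0)
    (hxx : ∀ i j, i ≠ j → x i ≠ x j) (hxx' : ∀ i j, i ≠ j → x i * x j ≠ 1)
    (ha : a ∉ S) {k : ι} (hk : k ∈ S) :
    ∑ A ∈ S.powerset, (boundaryCoef t d x S A *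
      ((gcoef t (x a)⁻¹ (invOn x A k) - gcoef t (x a) (invOn x A k)) * d (invOn x A k) *
        ∏ j ∈ S.erase k, fcoef t (invOn x A k) (invOn x A j))) •
        bethe C (invOn x A) v₀ (S.erase k) = 0 := by
  have hka : a ≠ k := fun e => ha (e ▸ hk)
  obtain ⟨S, hkS, rfl⟩ : ∃ S', k ∉ S' ∧ S = insert k S' :=
    ⟨S.erase k, Finset.notMem_erase k S, (Finset.insert_erase hk).symm⟩
  rw [Finset.sum_powerset_insert hkS, ← Finset.sum_add_distrib]
  refine Finset.sum_eq_zero fun A hA => ?_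
  rw [Finset.mem_powerset] at hA
  have hkA : k ∉ A := fun h => hkS (hA h)
  have h : ∀ i ∈ S, invOn x (insert k A) i = invOn x A i :=
    fun i hi => invOn_insert_of_ne fun e => hkS (e ▸ hi)
  rw [Finset.erase_insert hkS, bethe_congr h, ← add_smul, boundaryCoef_insert t d hkS hA,
    boundaryCoef_insert_insert t d hkS hA, invOn_of_notMem hkA,
    invOn_of_mem (Finset.mem_insert_self k A),
    Finset.prod_congr rfl fun i hi => congrArg (fcoef t (x k)⁻¹) (h i hi),
    Finset.prod_congr (f := fun j => fcoef t (x k)⁻¹ (invOn x A j)) rfl fun i _ =>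
      fcoef_inv t (invOn_ne_zero hx0 i),
    Finset.prod_congr (f := fun j => fcoef t (x k) (invOn x A j)) rfl fun i _ =>
      fcoef_eq_pairFactor t (invOn_ne_zero hx0 i)]
  have hg := gcoef_cancel t (hx0 a) (hx0 k) (hxx a k hka) (hxx' a k hka)
  convert zero_smul F _ using 2
  linear_combination (boundaryCoef t d x S A * d (x k) * d (x k)⁻¹ *
    (∏ j ∈ S, pairFactor t (x k) (invOn x A j)) *
    ∏ j ∈ S, pairFactor t (x k)⁻¹ (invOn x A j)) * hg

/-- The wanted terms of the two summands give the subsets without and with `a`. The unwanted terms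
of both carry the same vector `C(x a) C((x a)⁻¹) ⋯`, so their coefficients can be subtracted and the
sum over subsets vanishes. -/
theorem ExchangeAlgebra.boundaryBethe_insert (h : ExchangeAlgebra t C D) {d : F → F}
    (hd : ∀ u, D u v₀ = d u • v₀) (hx0 : ∀ i, x i ≠ 0)
    (hxx : ∀ i j, i ≠ j → x i ≠ x j) (hxx' : ∀ i j, i ≠ j → x i * x j ≠ 1) (ha : a ∉ S) :
    C (x a) (D (x a)⁻¹ (boundaryBethe t d C x v₀ S)) -
      C (x a)⁻¹ (D (x a) (boundaryBethe t d C x v₀ S)) =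
      boundaryBethe t d C x v₀ (insert a S) := by
  have hne := fun A => ne_invOn (A := A) hx0 hxx hxx'
  have hinj := fun A => invOn_injective (A := A) hx0 hxx hxx'
  have haS : ∀ i ∈ S, a ≠ i := fun i hi e => ha (e ▸ hi)
  have key : ∀ A ∈ S.powerset, boundaryCoef t d x S A •
      (C (x a) (D (x a)⁻¹ (bethe C (invOn x A) v₀ S)) -
        C (x a)⁻¹ (D (x a) (bethe C (invOn x A) v₀ S))) =
      (boundaryCoef t d x (insert a S) A • bethe C (invOn x A) v₀ (insert a S) +
        boundaryCoef t d x (insert a S) (insert a A) •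
          bethe C (invOn x (insert a A)) v₀ (insert a S)) +
      ∑ k ∈ S, C (x a) (C (x a)⁻¹ ((boundaryCoef t d x S A *
      ((gcoef t (x a)⁻¹ (invOn x A k) - gcoef t (x a) (invOn x A k)) * d (invOn x A k) *
        ∏ j ∈ S.erase k, fcoef t (invOn x A k) (invOn x A j))) •
        bethe C (invOn x A) v₀ (S.erase k))) := by
    intro A hA
    rw [Finset.mem_powerset] at hA
    have haA : a ∉ A := fun h => ha (hA h)
    have hi : ∀ i ∈ S, invOn x (insert a A) i = invOn x A i :=
      fun i hi => invOn_insert_of_ne fun e => ha (e ▸ hi)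
    have hCC : ∀ w, C (x a)⁻¹ (C (x a) w) = C (x a) (C (x a)⁻¹ w) := fun w =>
      LinearMap.congr_fun (h.comm_C _ _) w
    rw [h.D_bethe hd (hinj A).injOn fun i hi => (hne A a i (haS i hi)).2,
      h.D_bethe hd (hinj A).injOn fun i hi => (hne A a i (haS i hi)).1,
      bethe_insert h.comm_C ha, bethe_insert h.comm_C ha, bethe_congr hi,
      invOn_of_mem (Finset.mem_insert_self a A), invOn_of_notMem haA,
      boundaryCoef_insert t d ha hA, boundaryCoef_insert_insert t d ha hA,
      Finset.prod_congr (f := fun j => fcoef t (x a)⁻¹ (invOn x A j)) rfl fun i _ =>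
        fcoef_inv t (invOn_ne_zero hx0 i),
      Finset.prod_congr (f := fun j => fcoef t (x a) (invOn x A j)) rfl fun i _ =>
        fcoef_eq_pairFactor t (invOn_ne_zero hx0 i)]
    have hs : ∀ k ∈ S, C (x a) (C (x a)⁻¹ ((boundaryCoef t d x S A *
      ((gcoef t (x a)⁻¹ (invOn x A k) - gcoef t (x a) (invOn x A k)) * d (invOn x A k) *
        ∏ j ∈ S.erase k, fcoef t (invOn x A k) (invOn x A j))) •
        bethe C (invOn x A) v₀ (S.erase k))) =
        boundaryCoef t d x S A • ((gcoef t (x a)⁻¹ (invOn x A k) * d (invOn x A k) *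
          ∏ j ∈ S.erase k, fcoef t (invOn x A k) (invOn x A j)) •
          C (x a) (C (x a)⁻¹ (bethe C (invOn x A) v₀ (S.erase k)))) -
        boundaryCoef t d x S A • ((gcoef t (x a) (invOn x A k) * d (invOn x A k) *
          ∏ j ∈ S.erase k, fcoef t (invOn x A k) (invOn x A j)) •
          C (x a) (C (x a)⁻¹ (bethe C (invOn x A) v₀ (S.erase k)))) := by
      intro k _
      simp only [map_smul]
      module
    rw [Finset.sum_congr rfl hs, Finset.sum_sub_distrib, ← Finset.smul_sum, ← Finset.smul_sum]
    simp only [map_add, map_smul, map_sum, hCC]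
    module
  have lhs : C (x a) (D (x a)⁻¹ (boundaryBethe t d C x v₀ S)) -
      C (x a)⁻¹ (D (x a) (boundaryBethe t d C x v₀ S)) =
      ∑ A ∈ S.powerset, boundaryCoef t d x S A •
      (C (x a) (D (x a)⁻¹ (bethe C (invOn x A) v₀ S)) -
        C (x a)⁻¹ (D (x a) (bethe C (invOn x A) v₀ S))) := by
    simp only [boundaryBethe, map_sum, map_smul, smul_sub, Finset.sum_sub_distrib]
  rw [lhs, Finset.sum_congr rfl key, Finset.sum_add_distrib, Finset.sum_add_distrib,
    Finset.sum_comm, boundaryBethe, Finset.sum_powerset_insert ha]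
  convert add_zero _ using 2
  refine Finset.sum_eq_zero fun k hk => ?_
  rw [← map_sum, ← map_sum, boundary_unwanted d hx0 hxx hxx' ha hk, map_zero, map_zero]

/-- The double-row operator built from two single rows. -/
noncomputable def doubleOp (t : F) (C D : F → Module.End F V) (x : F) : Module.End F V :=
  D x⁻¹ * C x - t • (C x⁻¹ * D x)

/-- The weight `-t` in `⟨K|` is what makes this work: `g(x⁻¹, x) - t = -f(x⁻¹, x)`, so the two terms
acquire opposite coefficients. -/
theorem ExchangeAlgebra.doubleOp_eq (h : ExchangeAlgebra t C D) {x : F} (hx0 : x ≠ 0)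
    (hx1 : x ^ 2 ≠ 1) :
    doubleOp t C D x = ((x - t * x⁻¹) / (x - x⁻¹)) • (C x * D x⁻¹ - C x⁻¹ * D x) := by
  have h1 : x - x⁻¹ ≠ 0 := by
    intro e
    apply hx1
    field_simp at e
    linear_combination e
  have hne : x⁻¹ ≠ x := fun e => h1 (by rw [e, sub_self])
  rw [doubleOp, h.D_mul_C hne, fcoef, gcoef]
  match_scalars <;> field_simp
  ring

theorem ExchangeAlgebra.prod_doubleOp (h : ExchangeAlgebra t C D) {d : F → F}
    (hd : ∀ u, D u v₀ = d u • v₀) (hx0 : ∀ i, x i ≠ 0) (hx1 : ∀ i, x i ^ 2 ≠ 1)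
    (hxx : ∀ i j, i ≠ j → x i ≠ x j) (hxx' : ∀ i j, i ≠ j → x i * x j ≠ 1)
    (l : List ι) (hl : l.Nodup) :
    (l.map fun i => doubleOp t C D (x i)).prod v₀ =
      (∏ i ∈ l.toFinset, ((x i - t * (x i)⁻¹) / (x i - (x i)⁻¹))) •
        boundaryBethe t d C x v₀ l.toFinset := by
  induction l with
  | nil => simp [boundaryBethe, boundaryCoef, pairProd]
  | cons a l ih =>
    have ha : a ∉ l.toFinset := by simpa using (List.nodup_cons.1 hl).1
    rw [List.map_cons, List.prod_cons, Module.End.mul_apply, ih (List.nodup_cons.1 hl).2,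
      h.doubleOp_eq (hx0 a) (hx1 a), List.toFinset_cons, Finset.prod_insert ha,
      ← h.boundaryBethe_insert hd hx0 hxx hxx' ha]
    simp only [map_smul, LinearMap.smul_apply, LinearMap.sub_apply, Module.End.mul_apply]
    module

end

/-! ### Splitting off the leftmost site from a Bethe vector -/

section Coproduct

variable {ι : Type*} [DecidableEq ι] {t : F} {y : ι → F}

/-- Partial fractions in `x`: the product tends to `1` at infinity and has simple poles at the
points `y k`, and the summands carry its residues. -/
theorem prod_fcoef_eq (t : F) {J : Finset ι} (hy : Set.InjOn y J) {x : F}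
    (hx : ∀ i ∈ J, x ≠ y i) :
    ∏ i ∈ J, fcoef t (y i) x =
      1 + ∑ k ∈ J, gcoef t x (y k) * ∏ i ∈ J.erase k, fcoef t (y i) (y k) := by
  induction J using Finset.induction_on generalizing x with
  | empty => simp
  | insert z J hz ih =>
    have hyJ : Set.InjOn y J := hy.mono (by simp)
    have hxJ : ∀ i ∈ J, x ≠ y i := fun i hi => hx i (Finset.mem_insert_of_mem hi)
    have hxz : x ≠ y z := hx z (Finset.mem_insert_self _ _)
    have hzJ : ∀ i ∈ J, y z ≠ y i := fun i hi e =>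
      hz (hy (Finset.mem_insert_self _ _) (Finset.mem_insert_of_mem hi) e ▸ hi)
    have h1 : fcoef t (y z) x = 1 + gcoef t x (y z) := by
      have := sub_ne_zero.2 hxz
      have := sub_ne_zero.2 hxz.symm
      unfold fcoef gcoef
      field_simp
      ring
    have hk : ∀ k ∈ J, gcoef t x (y k) * ∏ i ∈ (insert z J).erase k, fcoef t (y i) (y k) =
        fcoef t (y z) x * (gcoef t x (y k) * ∏ i ∈ J.erase k, fcoef t (y i) (y k)) -
        gcoef t x (y z) * (gcoef t (y z) (y k) * ∏ i ∈ J.erase k, fcoef t (y i) (y k)) := by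
      intro k hk
      have hne : z ≠ k := fun e => hz (e ▸ hk)
      have hz' : z ∉ J.erase k := fun e => hz (Finset.mem_of_mem_erase e)
      rw [Finset.erase_insert_of_ne hne, Finset.prod_insert hz']
      have h2 : fcoef t (y z) x * gcoef t x (y k) =
          gcoef t x (y z) * gcoef t (y z) (y k) + gcoef t x (y k) * fcoef t (y z) (y k) := by
        have := sub_ne_zero.2 hxz
        have := sub_ne_zero.2 hxz.symm
        have := sub_ne_zero.2 (hxJ k hk).symm
        have := sub_ne_zero.2 (hzJ k hk).symm
        unfold fcoef gcoef
        field_simp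
        ring
      linear_combination (-∏ i ∈ J.erase k, fcoef t (y i) (y k)) * h2
    rw [Finset.prod_insert hz, Finset.sum_insert hz, Finset.erase_insert hz,
      Finset.sum_congr rfl hk, Finset.sum_sub_distrib, ← Finset.mul_sum, ← Finset.mul_sum,
      ih hyJ hxJ, ih hyJ hzJ, h1]
    ring

/-- The interaction of the variables in `I` with those in `J`. -/
def crossProd (t : F) (y : ι → F) (I J : Finset ι) : F := ∏ i ∈ I, ∏ j ∈ J, fcoef t (y i) (y j)

theorem crossProd_insert_left (t : F) {I J : Finset ι} {a : ι} (ha : a ∉ I) :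
    crossProd t y (insert a I) J = (∏ j ∈ J, fcoef t (y a) (y j)) * crossProd t y I J := by
  rw [crossProd, Finset.prod_insert ha, crossProd]

theorem crossProd_insert_right (t : F) {I J : Finset ι} {a : ι} (ha : a ∉ J) :
    crossProd t y I (insert a J) = (∏ i ∈ I, fcoef t (y i) (y a)) * crossProd t y I J := by
  simp only [crossProd, Finset.prod_insert ha, Finset.prod_mul_distrib]

variable {V : Type*} [AddCommGroup V] [Module F V]
variable {C D C' D' : F → Module.End F V} {P : Module.End F V} {v₀ : V}

theorem sum_powerset_sdiff_comm {M : Type*} [AddCommMonoid M] (S : Finset ι)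
    (f : Finset ι → ι → M) :
    ∑ I ∈ S.powerset, ∑ k ∈ S \ I, f I k = ∑ J ∈ S.powerset, ∑ k ∈ J, f (J.erase k) k := by
  rw [Finset.sum_sigma', Finset.sum_sigma']
  refine Finset.sum_bij' (fun p _ => ⟨insert p.2 p.1, p.2⟩) (fun p _ => ⟨p.1.erase p.2, p.2⟩)
    ?_ ?_ ?_ ?_ ?_
  · rintro ⟨I, k⟩ h
    simp only [Finset.mem_sigma, Finset.mem_powerset, Finset.mem_sdiff] at h ⊢
    exact ⟨Finset.insert_subset h.2.1 h.1, Finset.mem_insert_self _ _⟩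
  · rintro ⟨J, k⟩ h
    simp only [Finset.mem_sigma, Finset.mem_powerset, Finset.mem_sdiff] at h ⊢
    exact ⟨(Finset.erase_subset _ _).trans h.1, h.1 h.2, Finset.notMem_erase _ _⟩
  · rintro ⟨I, k⟩ h
    simp only [Finset.mem_sigma, Finset.mem_powerset, Finset.mem_sdiff] at h ⊢
    rw [Finset.erase_insert h.2.2]
  · rintro ⟨J, k⟩ h
    simp only [Finset.mem_sigma, Finset.mem_powerset] at h ⊢
    rw [Finset.insert_erase h.2]
  · rintro ⟨I, k⟩ h
    simp only [Finset.mem_sigma, Finset.mem_powerset, Finset.mem_sdiff] at h ⊢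
    rw [Finset.erase_insert h.2.2]

/-- The Bethe vector of a row with one more site at its left end. -/
theorem ExchangeAlgebra.bethe_coproduct (h : ExchangeAlgebra t C' D')
    (hC : ∀ u v, C u * C v = C v * C u) (hv : ∀ u, D' u v₀ = v₀)
    (hPC : ∀ u, C' u * P = P * C' u) (hPD : ∀ u, D' u * P = P * D' u)
    (hCP : ∀ u, C u = u • C' u + u • (P * D' u)) {S : Finset ι} (hy : Set.InjOn y S) :
    bethe C y v₀ S = ∑ I ∈ S.powerset, ((∏ i ∈ S, y i) * crossProd t y I (S \ I)) •
      (P ^ I.card) (bethe C' y v₀ (S \ I)) := by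
  have hPC' : ∀ u n w, C' u ((P ^ n) w) = (P ^ n) (C' u w) := fun u n w =>
    LinearMap.congr_fun (Commute.pow_right (show Commute (C' u) P from hPC u) n) w
  have hPD' : ∀ u n w, D' u ((P ^ n) w) = (P ^ n) (D' u w) := fun u n w =>
    LinearMap.congr_fun (Commute.pow_right (show Commute (D' u) P from hPD u) n) w
  have hPs : ∀ n w, P ((P ^ n) w) = (P ^ (n + 1)) w := fun n w => by
    rw [pow_succ']; rfl
  induction S using Finset.induction_on with
  | empty => simp [crossProd]
  | insert a S ha ih =>
    have hyS : Set.InjOn y S := hy.mono (by simp)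
    have hya : ∀ i ∈ S, y a ≠ y i := fun i hi e =>
      ha (hy (Finset.mem_insert_self _ _) (Finset.mem_insert_of_mem hi) e ▸ hi)
    set x := y a with hx
    have hD : ∀ I ∈ S.powerset, D' x (bethe C' y v₀ (S \ I)) =
        (∏ j ∈ S \ I, fcoef t x (y j)) • bethe C' y v₀ (S \ I) +
        ∑ k ∈ S \ I, (gcoef t x (y k) * ∏ j ∈ (S \ I).erase k, fcoef t (y k) (y j)) •
          C' x (bethe C' y v₀ ((S \ I).erase k)) := by
      intro I _
      rw [h.D_bethe (d := fun _ => 1) (by simpa using hv) (hyS.mono (by simp))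
        fun i hi => hya i (Finset.sdiff_subset hi)]
      simp
    -- Collects the terms in which `J` is the set of variables leaving a particle at the new site
    -- and `a ∉ J`. Either `C'(x)` acted directly, or `P D'(x)` traded parameters with some `k ∈ J`
    -- that had not yet left one. By `prod_fcoef_eq` these add up to the interaction of `J` with
    -- `a`.
    have key : ∀ J ∈ S.powerset, crossProd t y J (S \ J) • (P ^ J.card)
          (C' x (bethe C' y v₀ (S \ J))) +
        ∑ k ∈ J, (crossProd t y (J.erase k) (S \ J.erase k) * (gcoef t x (y k) *
          ∏ j ∈ (S \ J.erase k).erase k, fcoef t (y k) (y j))) •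
          (P ^ ((J.erase k).card + 1)) (C' x (bethe C' y v₀ ((S \ J.erase k).erase k))) =
        crossProd t y J (insert a (S \ J)) • (P ^ J.card) (C' x (bethe C' y v₀ (S \ J))) := by
      intro J hJ
      rw [Finset.mem_powerset] at hJ
      have haJ : a ∉ S \ J := fun e => ha (Finset.sdiff_subset e)
      have hk : ∀ k ∈ J, (crossProd t y (J.erase k) (S \ J.erase k) * (gcoef t x (y k) *
          ∏ j ∈ (S \ J.erase k).erase k, fcoef t (y k) (y j))) •
          (P ^ ((J.erase k).card + 1)) (C' x (bethe C' y v₀ ((S \ J.erase k).erase k))) =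
          (crossProd t y J (S \ J) * (gcoef t x (y k) * ∏ i ∈ J.erase k, fcoef t (y i) (y k))) •
            (P ^ J.card) (C' x (bethe C' y v₀ (S \ J))) := by
        intro k hk
        have e1 : S \ J.erase k = insert k (S \ J) := by
          rw [Finset.sdiff_erase (hJ hk)]
        have hk' : k ∉ S \ J := fun e => (Finset.mem_sdiff.1 e).2 hk
        rw [Finset.card_erase_add_one hk, e1, Finset.erase_insert hk',
          crossProd_insert_right t hk']
        conv_rhs => rw [← Finset.insert_erase hk,
          crossProd_insert_left t (Finset.notMem_erase k J), Finset.insert_erase hk]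
        congr 1
        ring
      rw [Finset.sum_congr rfl hk, ← Finset.sum_smul, ← add_smul, ← Finset.mul_sum,
        crossProd_insert_right t haJ, ← hx, prod_fcoef_eq t (hyS.mono (by simpa using hJ))
          fun i hi => hya i (hJ hi)]
      congr 1
      ring
    -- The subsets of `insert a S` without and with `a`; the latter come from the wanted term of `P
    -- D'(x)`.
    have hins : ∀ I ∈ S.powerset,
        ((∏ i ∈ insert a S, y i) * crossProd t y I (insert a S \ I)) •
          (P ^ I.card) (bethe C' y v₀ (insert a S \ I)) +
        ((∏ i ∈ insert a S, y i) * crossProd t y (insert a I) (insert a S \ insert a I)) •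
          (P ^ (insert a I).card) (bethe C' y v₀ (insert a S \ insert a I)) =
        (x * ∏ i ∈ S, y i) • (crossProd t y I (insert a (S \ I)) •
          (P ^ I.card) (C' x (bethe C' y v₀ (S \ I)))) +
        (x * ∏ i ∈ S, y i) • ((crossProd t y I (S \ I) * ∏ j ∈ S \ I, fcoef t x (y j)) •
          (P ^ (I.card + 1)) (bethe C' y v₀ (S \ I))) := by
      intro I hI
      rw [Finset.mem_powerset] at hI
      have haI : a ∉ I := fun e => ha (hI e)
      have haJ : a ∉ S \ I := fun e => ha (Finset.sdiff_subset e)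
      have e1 : insert a S \ I = insert a (S \ I) := Finset.insert_sdiff_of_notMem _ haI
      have e2 : insert a S \ insert a I = S \ I := by
        rw [Finset.insert_sdiff_insert, Finset.sdiff_insert_of_notMem ha]
      rw [e1, e2, Finset.prod_insert ha, Finset.card_insert_of_notMem haI,
        crossProd_insert_left t haI, bethe_insert h.comm_C haJ, ← hx]
      simp only [smul_smul]
      congr 2
      ring
    rw [bethe_insert hC ha, ih hyS, Finset.sum_powerset_insert ha, ← Finset.sum_add_distrib,
      Finset.sum_congr rfl hins, Finset.sum_add_distrib, ← Finset.smul_sum, ← Finset.smul_sum,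
      ← Finset.sum_congr rfl key, Finset.sum_add_distrib, ← sum_powerset_sdiff_comm S
        fun I k => (crossProd t y I (S \ I) * (gcoef t x (y k) *
          ∏ j ∈ (S \ I).erase k, fcoef t (y k) (y j))) •
          (P ^ (I.card + 1)) (C' x (bethe C' y v₀ ((S \ I).erase k))), ← hx, hCP]
    have hT : ∀ I ∈ S.powerset, (x • C' x + x • (P * D' x))
        (((∏ i ∈ S, y i) * crossProd t y I (S \ I)) • (P ^ I.card) (bethe C' y v₀ (S \ I))) =
        (x * ∏ i ∈ S, y i) • (crossProd t y I (S \ I) •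
          (P ^ I.card) (C' x (bethe C' y v₀ (S \ I)))) +
        (x * ∏ i ∈ S, y i) • ((crossProd t y I (S \ I) * ∏ j ∈ S \ I, fcoef t x (y j)) •
          (P ^ (I.card + 1)) (bethe C' y v₀ (S \ I))) +
        (x * ∏ i ∈ S, y i) • ∑ k ∈ S \ I, (crossProd t y I (S \ I) * (gcoef t x (y k) *
          ∏ j ∈ (S \ I).erase k, fcoef t (y k) (y j))) •
          (P ^ (I.card + 1)) (C' x (bethe C' y v₀ ((S \ I).erase k))) := by
      intro I hI
      simp only [mul_smul (crossProd t y I (S \ I)), ← Finset.smul_sum]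
      simp only [map_smul, LinearMap.add_apply, LinearMap.smul_apply, Module.End.mul_apply, hPC',
        hPD', hPs, hD I hI, map_add, map_sum]
      module
    rw [map_sum, Finset.sum_congr rfl hT]
    simp only [Finset.sum_add_distrib, ← Finset.smul_sum]
    module

end Coproduct

/-! ### Relations between the operators of the lattice -/

theorem cre_mul_ann (t : F) (s : Site) : cre s * ann t s = 1 - tnum t s := by
  refine LinearMap.ext fun f => funext fun m => ?_
  by_cases h : m s = 0
  · simp [ann, cre, tnum, h]
  · have hle : Finsupp.single s 1 ≤ m := Finsupp.single_le_iff.2 (Nat.one_le_iff_ne_zero.2 h)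
    have h1 : m s - 1 + 1 = m s := by omega
    simp [ann, cre, tnum, h, tsub_add_cancel_of_le hle, h1]
    ring

theorem ann_mul_cre (t : F) (s : Site) : ann t s * cre s = 1 - t • tnum t s := by
  rw [← sub_eq_zero]
  have h := boson_relation t s
  rw [cre_mul_ann] at h
  rw [← sub_eq_zero] at h
  rw [← h]
  module

theorem tnum_mul_cre (t : F) (s : Site) : tnum t s * cre s = t • (cre s * tnum t s) := by
  refine LinearMap.ext fun f => funext fun m => ?_
  by_cases h : m s = 0
  · simp [cre, tnum, h]
  · have h1 : t ^ m s = t * t ^ (m s - 1) := by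
      rw [← pow_succ']; congr 1; omega
    simp [cre, tnum, h, h1, mul_assoc]

theorem ann_mul_tnum (t : F) (s : Site) : ann t s * tnum t s = t • (tnum t s * ann t s) := by
  refine LinearMap.ext fun f => funext fun m => ?_
  simp [ann, tnum]
  ring

/-- The operators of one site. -/
inductive IsSiteOp (t : F) (s : Site) : Module.End F (Space F) → Prop
  | ann : IsSiteOp t s (ann t s)
  | cre : IsSiteOp t s (cre s)
  | tnum : IsSiteOp t s (tnum t s)

theorem add_single_sub_single {r s : Site} (h : r ≠ s) (m : State) :
    m + Finsupp.single r 1 - Finsupp.single s 1 = m - Finsupp.single s 1 + Finsupp.single r 1 := by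
  ext k
  by_cases hr : k = r
  · subst hr
    simp [h]
  · simp [hr, Finsupp.single_apply]

theorem IsSiteOp.commute {t : F} {r s : Site} (h : r ≠ s) {A B : Module.End F (Space F)}
    (hA : IsSiteOp t r A) (hB : IsSiteOp t s B) : A * B = B * A := by
  have h' := h.symm
  refine LinearMap.ext fun f => funext fun m => ?_
  cases hA <;> cases hB
  · simp [BCHL.ann, h, h', add_right_comm m (Finsupp.single r 1)]
    ring
  · by_cases hs : m s = 0 <;>
      simp [BCHL.ann, BCHL.cre, h, h', hs, add_single_sub_single h m]
  · simp [BCHL.ann, BCHL.tnum, h']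
    ring
  · by_cases hs : m r = 0 <;>
      simp [BCHL.ann, BCHL.cre, h, h', hs, add_single_sub_single h' m]
  · by_cases hr : m r = 0 <;> by_cases hs : m s = 0 <;>
      simp [BCHL.cre, h, h', hr, hs, tsub_right_comm (a := m) (b := Finsupp.single r 1)]
  · by_cases hr : m r = 0 <;> simp [BCHL.cre, BCHL.tnum, h', hr]
  · simp [BCHL.ann, BCHL.tnum, h]
    ring
  · by_cases hs : m s = 0 <;> simp [BCHL.cre, BCHL.tnum, h, hs]
  · simp [BCHL.tnum]
    ring

/-! ### The columns of monodromy matrices -/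

/-- The bulk monodromy matrix on a list of sites. -/
noncomputable def monodromy (t : F) (l : List Site) (x : F) :
    Matrix (Fin 2) (Fin 2) (Module.End F (Space F)) :=
  (l.map fun s => Lmat t x s).prod

theorem monodromy_cons (t : F) (s : Site) (l : List Site) (x : F) :
    monodromy t (s :: l) x = Lmat t x s * monodromy t l x := by
  simp [monodromy]

theorem Lmat_entries_mem (t x : F) (s : Site) (S : Subalgebra F (Module.End F (Space F)))
    (h : ∀ A, IsSiteOp t s A → A ∈ S) (i j : Fin 2) : Lmat t x s i j ∈ S.toSubring := by
  rw [Subalgebra.mem_toSubring]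
  fin_cases i <;> fin_cases j
  · exact S.smul_mem (one_mem S) x
  · exact S.smul_mem (h _ .cre) x
  · exact h _ .ann
  · exact one_mem S

theorem Bmat_entries_mem (t c x : F) (s : Site) (S : Subalgebra F (Module.End F (Space F)))
    (h : ∀ A, IsSiteOp t s A → A ∈ S) (i j : Fin 2) : Bmat t c x s i j ∈ S.toSubring := by
  rw [Subalgebra.mem_toSubring]
  fin_cases i <;> fin_cases j
  · exact h _ .tnum
  · exact S.smul_mem (mul_mem (h _ .cre) (h _ .tnum)) _
  · exact h _ .ann
  · exact sub_mem (one_mem S) (S.smul_mem (h _ .tnum) _)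

theorem one_entries_mem {R : Type*} [Ring R] (S : Subring R) (i j : Fin 2) :
    (1 : Matrix (Fin 2) (Fin 2) R) i j ∈ S := by
  rw [Matrix.one_apply]
  split_ifs
  exacts [one_mem S, zero_mem S]

theorem monodromy_entries_mem (t x : F) (l : List Site)
    (S : Subalgebra F (Module.End F (Space F))) (h : ∀ s ∈ l, ∀ A, IsSiteOp t s A → A ∈ S)
    (i j : Fin 2) : monodromy t l x i j ∈ S.toSubring := by
  induction l generalizing i j with
  | nil => exact one_entries_mem _ i j
  | cons s l ih =>
    rw [monodromy_cons]
    exact mul_entries_mem _ (Lmat_entries_mem t x s S (h s (by simp)))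
      (fun i j => ih (fun r hr => h r (by simp [hr])) i j) i j

theorem monodromy_commute (t x : F) {s : Site} {l : List Site} (hs : s ∉ l)
    {A : Module.End F (Space F)} (hA : IsSiteOp t s A) (i j : Fin 2) :
    monodromy t l x i j * A = A * monodromy t l x i j := by
  have h := monodromy_entries_mem t x l (Subalgebra.centralizer F {A})
    (fun r hr B hB => (Subalgebra.mem_centralizer_iff F).2 fun g hg => by
      rw [Set.mem_singleton_iff.1 hg]
      exact hA.commute (fun e : s = r => hs (e ▸ hr)) hB) i j
  exact ((Subalgebra.mem_centralizer_iff F).1 h A rfl).symm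

theorem exchangeAlgebra_monodromy (t : F) {l : List Site} (hl : l.Nodup) :
    ExchangeAlgebra t (fun u => monodromy t l u 0 1) (fun u => monodromy t l u 1 1) := by
  induction l with
  | nil => simpa [monodromy] using ExchangeAlgebra.base (E := Module.End F (Space F)) t
  | cons s l ih =>
    obtain ⟨hs, hl⟩ := List.nodup_cons.1 hl
    have := (ih hl).left_mul_L (a := ann t s) (c := cre s)
      (by rw [ann_mul_cre, cre_mul_ann]; module)
      (fun u => monodromy_commute t u hs .ann 0 1) (fun u => monodromy_commute t u hs .ann 1 1)
      (fun u => monodromy_commute t u hs .cre 0 1) (fun u => monodromy_commute t u hs .cre 1 1)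
    simpa [monodromy_cons, Matrix.mul_apply, Lmat] using this

theorem ann_vacuum (t : F) (s : Site) : ann t s (ket F 0) = 0 := by
  rw [ann_ket]; simp

theorem tnum_vacuum (t : F) (s : Site) : tnum t s (ket F 0) = ket F 0 := by
  rw [tnum_ket]; simp

/-- A new site adds `φ C` to `D`; since `φ` commutes with `C` and kills the vacuum, this term does
not contribute. -/
theorem monodromy_vacuum (t u : F) {l : List Site} (hl : l.Nodup) :
    monodromy t l u 1 1 (ket F 0) = ket F 0 := by
  induction l with
  | nil => simp [monodromy]
  | cons s l ih =>
    obtain ⟨hs, hl⟩ := List.nodup_cons.1 hl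
    have h := LinearMap.congr_fun (monodromy_commute t u hs .ann 0 1) (ket F 0)
    simp only [Module.End.mul_apply, ann_vacuum, map_zero] at h
    simp [monodromy_cons, Matrix.mul_apply, Lmat, ih hl, ← h]

/-- Multiplication of a column by a boundary tile at a site it does not involve. -/
theorem Bmat_column (t c : F) (s : Site)
    {M : F → Matrix (Fin 2) (Fin 2) (Module.End F (Space F))}
    (hM : ExchangeAlgebra t (fun u => M u 0 1) (fun u => M u 1 1))
    (hs : ∀ A, IsSiteOp t s A → ∀ u i j, M u i j * A = A * M u i j) :
    ExchangeAlgebra t (fun u => (Bmat t c u s * M u) 0 1) (fun u => (Bmat t c u s * M u) 1 1) := by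
  have := hM.left_mul_B (a := ann t s) (c := cre s) (q := tnum t s) c (ann_mul_cre t s)
    (cre_mul_ann t s) (tnum_mul_cre t s) (ann_mul_tnum t s)
    (fun u => hs _ .ann u 0 1) (fun u => hs _ .ann u 1 1)
    (fun u => hs _ .cre u 0 1) (fun u => hs _ .cre u 1 1)
    (fun u => hs _ .tnum u 0 1) (fun u => hs _ .tnum u 1 1)
  simpa [Matrix.mul_apply, Bmat] using this

theorem Bmat_vacuum (t c u e : F) (s : Site) {M : Matrix (Fin 2) (Fin 2) (Module.End F (Space F))}
    (hM : M 1 1 (ket F 0) = e • ket F 0) (hs : M 0 1 * ann t s = ann t s * M 0 1) :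
    (Bmat t c u s * M) 1 1 (ket F 0) = ((1 - c * u) * e) • ket F 0 := by
  have h := LinearMap.congr_fun hs (ket F 0)
  simp only [Module.End.mul_apply, ann_vacuum, map_zero] at h
  simp [Matrix.mul_apply, Bmat, hM, ← h, tnum_vacuum]
  module

/-- The sites `a, …, a + N - 1` of the bulk. -/
def bulkSites (a N : ℕ) : List Site := (List.range' a N).map Sum.inr

theorem nodup_bulkSites (a N : ℕ) : (bulkSites a N).Nodup :=
  (List.nodup_range' (s := a) (n := N)).map Sum.inr_injective

theorem bulkSites_succ (a N : ℕ) : bulkSites a (N + 1) = Sum.inr a :: bulkSites (a + 1) N := by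
  simp [bulkSites, List.range'_succ]

theorem row_eq (t γ δ x : F) (N : ℕ) : row t γ δ x N =
    Bmat t γ x (Sum.inl 0) * (Bmat t δ x (Sum.inl 1) * monodromy t (bulkSites 0 N) x) := by
  simp only [row, monodromy, bulkSites, List.range_eq_range', List.map_map, mul_assoc]
  rfl

theorem inl_notMem_bulkSites (k : Fin 2) (a N : ℕ) : Sum.inl k ∉ bulkSites a N := by
  simp [bulkSites]

theorem inner_row_commute (t δ x : F) (N : ℕ) {A : Module.End F (Space F)}
    (hA : IsSiteOp t (Sum.inl 0) A) (i j : Fin 2) :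
    (Bmat t δ x (Sum.inl 1) * monodromy t (bulkSites 0 N) x) i j * A =
      A * (Bmat t δ x (Sum.inl 1) * monodromy t (bulkSites 0 N) x) i j := by
  have hne : (Sum.inl 0 : Site) ≠ Sum.inl 1 := by simp
  have h1 := Bmat_entries_mem t δ x (Sum.inl 1) (Subalgebra.centralizer F {A})
    (fun B hB => (Subalgebra.mem_centralizer_iff F).2 fun g hg => by
      rw [Set.mem_singleton_iff.1 hg]
      exact hA.commute hne hB)
  have h2 : ∀ i j, monodromy t (bulkSites 0 N) x i j ∈
      (Subalgebra.centralizer F {A}).toSubring := fun i j => by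
    refine (Subalgebra.mem_centralizer_iff F).2 fun g hg => ?_
    rw [Set.mem_singleton_iff.1 hg]
    exact (monodromy_commute t x (inl_notMem_bulkSites 0 0 N) hA i j).symm
  exact ((Subalgebra.mem_centralizer_iff F).1 (mul_entries_mem _ h1 h2 i j) A rfl).symm

theorem exchangeAlgebra_row (t γ δ : F) (N : ℕ) :
    ExchangeAlgebra t (fun u => row t γ δ u N 0 1) (fun u => row t γ δ u N 1 1) := by
  simp only [row_eq]
  exact Bmat_column t γ _ (Bmat_column t δ _ (exchangeAlgebra_monodromy t (nodup_bulkSites 0 N))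
    fun A hA u => monodromy_commute t u (inl_notMem_bulkSites 1 0 N) hA)
    fun A hA u => inner_row_commute t δ u N hA

theorem row_vacuum (t γ δ u : F) (N : ℕ) :
    row t γ δ u N 1 1 (ket F 0) = ((1 - γ * u) * (1 - δ * u)) • ket F 0 := by
  rw [row_eq]
  refine Bmat_vacuum t γ u _ _ ?_ (inner_row_commute t δ u N .ann 0 1)
  rw [Bmat_vacuum t δ u 1 _ _ (monodromy_commute t u (inl_notMem_bulkSites 1 0 N) .ann 0 1),
    mul_one]
  rw [monodromy_vacuum t u (nodup_bulkSites 0 N), one_smul]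

/-! ### Truncation to finitely many sites -/

/-- The operators that do not lower the occupation of the sites in `Z`. -/
def preservingOn (F : Type*) [Field F] (Z : Set Site) :
    Subalgebra F (Module.End F (Space F)) where
  carrier := {A | ∀ f : Space F, (∀ m : State, (∀ s ∈ Z, m s = 0) → f m = 0) →
    ∀ m : State, (∀ s ∈ Z, m s = 0) → A f m = 0}
  mul_mem' hA hB f hf := hA _ (hB f hf)
  add_mem' hA hB f hf m hm := by simp [hA f hf m hm, hB f hf m hm]
  algebraMap_mem' c f hf m hm := by simp [Module.algebraMap_end_apply, hf m hm]

theorem IsSiteOp.mem_preservingOn {t : F} {r : Site} {Z : Set Site} (h : r ∉ Z)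
    {A : Module.End F (Space F)} (hA : IsSiteOp t r A) : A ∈ preservingOn F Z := by
  intro f hf m hm
  cases hA
  · have : f (m + Finsupp.single r 1) = 0 := hf _ fun s hs => by
      have : r ≠ s := fun e => h (e ▸ hs)
      simp [hm s hs, this]
    simp [BCHL.ann, this]
  · have : f (m - Finsupp.single r 1) = 0 := hf _ fun s hs => by simp [hm s hs]
    simp [BCHL.cre, this]
  · simp [BCHL.tnum, hf m hm]

/-- Coefficients of `A f` at states empty on `Z` depend only on such coefficients of `f`. This is
used with `Z` the distant bulk sites, to truncate the lattice, and with `Z` the boundary sites, to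
drop the boundary tiles. -/
theorem preservingOn_congr {Z : Set Site} {A : Module.End F (Space F)} (hA : A ∈ preservingOn F Z)
    {f g : Space F} (h : ∀ m : State, (∀ s ∈ Z, m s = 0) → f m = g m) {m : State}
    (hm : ∀ s ∈ Z, m s = 0) : A f m = A g m := by
  rw [← sub_eq_zero, ← Pi.sub_apply, ← map_sub]
  exact hA _ (fun k hk => by rw [Pi.sub_apply, h k hk, sub_self]) m hm

theorem prod_apply_congr {Z : Set Site} {ι : Type*} {A B : ι → Module.End F (Space F)}
    (hA : ∀ i, A i ∈ preservingOn F Z)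
    (h : ∀ i f (m : State), (∀ s ∈ Z, m s = 0) → A i f m = B i f m) (l : List ι) (f : Space F)
    {m : State} (hm : ∀ s ∈ Z, m s = 0) :
    (l.map A).prod f m = (l.map B).prod f m := by
  induction l generalizing m with
  | nil => rfl
  | cons i l ih =>
    simp only [List.map_cons, List.prod_cons, Module.End.mul_apply]
    rw [preservingOn_congr (hA i) (fun m hm => ih hm) hm, h i _ _ hm]

theorem cutoff_le {m : State} {N : ℕ} (h : ∀ i, N ≤ i → m (Sum.inr i) = 0) : cutoff m ≤ N := by
  refine Finset.sup_le fun s hs => ?_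
  rcases s with k | i
  · simp
  · by_contra hi
    exact Finsupp.mem_support_iff.1 hs (h i (by simpa using hi))

theorem doubleRowTrunc_eq (t γ δ x : F) (N : ℕ) : doubleRowTrunc t γ δ x N =
    doubleOp t (fun u => row t γ δ u N 0 1) (fun u => row t γ δ u N 1 1) x := by
  simp only [doubleRowTrunc, doubleOp, Fin.sum_univ_two, Kcov]
  simp
  module

theorem row_mem_preservingOn (t γ δ x : F) (N : ℕ) (i j : Fin 2) :
    row t γ δ x N i j ∈ preservingOn F {s | ∃ k, N ≤ k ∧ s = Sum.inr k} := by
  rw [row_eq]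
  refine mul_entries_mem (preservingOn F _).toSubring (Bmat_entries_mem t γ x _ _ fun A hA =>
    hA.mem_preservingOn (by simp)) (mul_entries_mem _ (Bmat_entries_mem t δ x _ _ fun A hA =>
    hA.mem_preservingOn (by simp)) (monodromy_entries_mem t x _ _ fun s hs A hA =>
    hA.mem_preservingOn ?_)) i j
  simp only [bulkSites, List.mem_map, List.mem_range'_1] at hs
  obtain ⟨k, hk, rfl⟩ := hs
  rintro ⟨j, hj, e⟩
  have := Sum.inr_injective e
  omega

theorem prod_doubleRow_apply {ι : Type*} (t γ δ : F) (x : ι → F) (l : List ι) (f : Space F)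
    (m : State) :
    (l.map fun i => doubleRow t γ δ (x i)).prod f m =
      (l.map fun i => doubleOp t (fun u => row t γ δ u (cutoff m) 0 1)
        (fun u => row t γ δ u (cutoff m) 1 1) (x i)).prod f m := by
  -- In `prod_apply_congr` only the first family has to lie in `preservingOn`. The truncated
  -- operators do, since they do not act on the sites in `Z`; hence one cutoff, that of the final
  -- state, serves the whole product.
  symm
  have hr := fun u i j => row_mem_preservingOn t γ δ u (cutoff m) i j
  refine prod_apply_congr (Z := {s | ∃ k, cutoff m ≤ k ∧ s = Sum.inr k}) (fun i => ?_)
    (fun i g k hk => ?_) l f ?_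
  · exact sub_mem (mul_mem (hr _ _ _) (hr _ _ _))
      (Subalgebra.smul_mem _ (mul_mem (hr _ _ _) (hr _ _ _)) _)
  · rw [← doubleRowTrunc_eq, doubleRow_apply]
    exact cutoff_le fun j hj => hk _ ⟨j, hj, rfl⟩
  · rintro s ⟨k, hk, rfl⟩
    exact eq_zero_of_cutoff_le hk

/-- A particle that enters the boundary from a row with a hole at its left end stays there. -/
theorem Bmat_mul_apply (t c x : F) {s : Site}
    (M : Matrix (Fin 2) (Fin 2) (Module.End F (Space F))) (f : Space F) {m : State}
    (hm : m s = 0) : (Bmat t c x s * M) 0 1 f m = M 0 1 f m := by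
  simp [Matrix.mul_apply, Bmat, tnum, cre, hm]

/-- The top row of a boundary tile has no annihilation operator, so `C` never removes a boundary
particle, and at a state with empty boundary sites only `t ^ 𝒩 = 1` survives. The parameters `γ`,
`δ` therefore enter only through the vacuum eigenvalue of `D`. -/
theorem bethe_row_apply {ι : Type*} (t γ δ : F) (y : ι → F) (N : ℕ) (f : Space F) (S : Finset ι)
    {m : State} (hm : ∀ k, m (Sum.inl k) = 0) :
    bethe (fun u => row t γ δ u N 0 1) y f S m =
      bethe (fun u => monodromy t (bulkSites 0 N) u 0 1) y f S m := by
  symm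
  refine prod_apply_congr (Z := Set.range Sum.inl) (fun i => ?_) (fun i g k hk => ?_) _ f
    (by rintro _ ⟨k, rfl⟩; exact hm k)
  · refine monodromy_entries_mem t _ _ _ (fun s hs A hA => hA.mem_preservingOn ?_) 0 1
    rintro ⟨k, rfl⟩
    exact inl_notMem_bulkSites k 0 N hs
  · dsimp only
    rw [row_eq, Bmat_mul_apply _ _ _ _ _ (hk _ ⟨0, rfl⟩), Bmat_mul_apply _ _ _ _ _ (hk _ ⟨1, rfl⟩)]

/-! ### Bulk Bethe vectors as Hall–Littlewood sums -/

section Bulk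

variable {ι : Type*} [DecidableEq ι]

/-- The state with a particle at the bulk site `κ i` for each `i ∈ S`. -/
noncomputable def bulkState (κ : ι → ℕ) (S : Finset ι) : State :=
  ∑ i ∈ S, Finsupp.single (Sum.inr (κ i)) 1

/-- The Hall–Littlewood weight of an assignment of parts `κ i ≥ a` to the variables in `S`. -/
def bulkWeight (t : F) (y : ι → F) (a : ℕ) (κ : ι → ℕ) (S : Finset ι) : F :=
  (∏ i ∈ S, y i ^ (κ i - a + 1)) *
    ∏ i ∈ S, ∏ j ∈ S, if κ j < κ i then fcoef t (y j) (y i) else 1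

theorem cre_pow_ket (s : Site) (k : ℕ) (m : State) :
    ((cre s : Module.End F (Space F)) ^ k) (ket F m) = ket F (m + k • Finsupp.single s 1) := by
  induction k with
  | zero => simp
  | succ k ih =>
    rw [pow_succ', Module.End.mul_apply, ih, cre_ket, succ_nsmul, add_assoc]

/-- Each variable pays one factor `y i` at site `a`, whether it stops there or moves on. The pairs
with `κ j < κ i` either have `j ∈ I` and `i ∉ I`, giving `crossProd`, or lie entirely outside `I`.
-/
theorem bulkWeight_split (t : F) (y : ι → F) (a : ℕ) {κ : ι → ℕ} {S I : Finset ι} (hI : I ⊆ S)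
    (h1 : ∀ i ∈ I, κ i = a) (h2 : ∀ i ∈ S \ I, a < κ i) :
    (∏ i ∈ S, y i) * crossProd t y I (S \ I) * bulkWeight t y (a + 1) κ (S \ I) =
      bulkWeight t y a κ S := by
  have e1 : ∏ i ∈ S, y i ^ (κ i - a + 1) =
      (∏ i ∈ S, y i) * ∏ i ∈ S \ I, y i ^ (κ i - (a + 1) + 1) := by
    rw [← Finset.prod_sdiff hI, ← Finset.prod_sdiff (f := y) hI]
    have e3 : ∀ i ∈ S \ I, y i ^ (κ i - a + 1) = y i * y i ^ (κ i - (a + 1) + 1) := by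
      intro i hi
      have := h2 i hi
      rw [← pow_succ']
      congr 1
      omega
    have e4 : ∀ i ∈ I, y i ^ (κ i - a + 1) = y i := by
      intro i hi
      simp [h1 i hi]
    rw [Finset.prod_congr rfl e3, Finset.prod_congr rfl e4, Finset.prod_mul_distrib]
    ring
  have e2 : (∏ i ∈ S, ∏ j ∈ S, if κ j < κ i then fcoef t (y j) (y i) else 1) =
      crossProd t y I (S \ I) *
        ∏ i ∈ S \ I, ∏ j ∈ S \ I, if κ j < κ i then fcoef t (y j) (y i) else 1 := by
    rw [← Finset.prod_sdiff hI]
    have e3 : ∏ i ∈ I, ∏ j ∈ S, (if κ j < κ i then fcoef t (y j) (y i) else 1) = 1 := by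
      refine Finset.prod_eq_one fun i hi => Finset.prod_eq_one fun j hj => if_neg ?_
      rw [h1 i hi]
      by_cases hjI : j ∈ I
      · simp [h1 j hjI]
      · exact (h2 j (Finset.mem_sdiff.2 ⟨hj, hjI⟩)).not_gt
    have e4 : ∀ i ∈ S \ I, (∏ j ∈ S, if κ j < κ i then fcoef t (y j) (y i) else 1) =
        (∏ j ∈ S \ I, if κ j < κ i then fcoef t (y j) (y i) else 1) *
          ∏ j ∈ I, fcoef t (y j) (y i) := by
      intro i hi
      rw [← Finset.prod_sdiff hI]
      congr 1
      refine Finset.prod_congr rfl fun j hj => if_pos ?_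
      rw [h1 j hj]
      exact h2 i hi
    rw [e3, Finset.prod_congr rfl e4, Finset.prod_mul_distrib, crossProd, Finset.prod_comm
      (s := S \ I) (t := I)]
    ring
  rw [bulkWeight, bulkWeight, e1, e2]
  ring

variable [Fintype ι]

/-- The assignments of sites `a, …, a + N - 1` to the elements of `S`, equal to `e` off `S`. -/
def assignments (a N : ℕ) (S : Finset ι) (e : ι → ℕ) : Finset (ι → ℕ) :=
  Fintype.piFinset fun i => if i ∈ S then Finset.Ico a (a + N) else {e i}

theorem mem_assignments {a N : ℕ} {S : Finset ι} {e κ : ι → ℕ} : κ ∈ assignments a N S e ↔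
    (∀ i ∈ S, a ≤ κ i ∧ κ i < a + N) ∧ ∀ i, i ∉ S → κ i = e i := by
  rw [assignments, Fintype.mem_piFinset, ← forall_and]
  refine forall_congr' fun i => ?_
  by_cases h : i ∈ S <;> simp [h]

/-- Values off the active set are pinned so that the recursion closes: fixing `I` as the set of
variables stopping at `a` adds `I` to the pinned ones. -/
theorem filter_assignments (a N : ℕ) {S I : Finset ι} (hI : I ⊆ S) (e : ι → ℕ) :
    {κ ∈ assignments a (N + 1) S e | {i ∈ S | κ i = a} = I} =
      assignments (a + 1) N (S \ I) fun i => if i ∈ I then a else e i := by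
  ext κ
  rw [Finset.mem_filter, mem_assignments, mem_assignments]
  constructor
  · rintro ⟨⟨h1, h2⟩, rfl⟩
    refine ⟨fun i hi => ?_, fun i hi => ?_⟩
    · simp only [Finset.mem_sdiff, Finset.mem_filter, not_and] at hi
      have := h1 i hi.1
      have := hi.2 hi.1
      omega
    · by_cases hiS : i ∈ S
      · by_cases hia : κ i = a
        · simp [hiS, hia]
        · simp [hiS, hia] at hi
      · simp [hiS, h2 i hiS]
  · rintro ⟨h1, h2⟩
    have h3 : ∀ i ∈ I, κ i = a := fun i hi => by
      rw [h2 i (by simp [hi]), if_pos hi]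
    refine ⟨⟨fun i hi => ?_, fun i hi => ?_⟩, ?_⟩
    · by_cases hiI : i ∈ I
      · have := h3 i hiI
        omega
      · have := h1 i (Finset.mem_sdiff.2 ⟨hi, hiI⟩)
        omega
    · rw [h2 i fun h => hi (Finset.sdiff_subset h), if_neg fun h => hi (hI h)]
    · ext i
      rw [Finset.mem_filter]
      refine ⟨fun ⟨hiS, hia⟩ => ?_, fun hi => ⟨hI hi, h3 i hi⟩⟩
      by_contra hiI
      have := h1 i (Finset.mem_sdiff.2 ⟨hiS, hiI⟩)
      omega

theorem bethe_monodromy (t : F) {y : ι → F} (N a : ℕ) (S : Finset ι) (hy : Set.InjOn y S)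
    (e : ι → ℕ) :
    bethe (fun u => monodromy t (bulkSites a N) u 0 1) y (ket F 0) S =
      ∑ κ ∈ assignments a N S e, bulkWeight t y a κ S • ket F (bulkState κ S) := by
  induction N generalizing a S e with
  | zero =>
    rcases S.eq_empty_or_nonempty with rfl | ⟨i, hi⟩
    · have : assignments a 0 ∅ e = {e} := by
        ext κ
        simp [mem_assignments, funext_iff]
      rw [this]
      simp [bulkWeight, bulkState]
    · have h0 : assignments a 0 S e = ∅ := by
        refine Finset.eq_empty_of_forall_notMem fun κ hκ => ?_
        have := (mem_assignments.1 hκ).1 i hi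
        omega
      -- On a row without sites the entry `C` is zero and independent of its parameter, so its
      -- commutation is definitional and the vector vanishes, in agreement with the empty set of
      -- assignments.
      rw [h0, Finset.sum_empty, bethe_erase (fun u v => rfl) hi]
      simp [monodromy, bulkSites]
  | succ N ih =>
    have hs : (Sum.inr a : Site) ∉ bulkSites (a + 1) N := by simp [bulkSites]
    rw [(exchangeAlgebra_monodromy t (nodup_bulkSites (a + 1) N)).bethe_coproduct
      (P := cre (Sum.inr a)) (exchangeAlgebra_monodromy t (nodup_bulkSites a (N + 1))).comm_C
      (fun u => monodromy_vacuum t u (nodup_bulkSites _ _))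
      (fun u => monodromy_commute t u hs .cre 0 1) (fun u => monodromy_commute t u hs .cre 1 1)
      (fun u => by simp [bulkSites_succ, monodromy_cons, Matrix.mul_apply, Lmat]) hy,
      -- Assignments are grouped by the set `I` of variables sent to the leftmost site `a`, to match
      -- the sum over `I` in the coproduct.
      ← Finset.sum_fiberwise_of_maps_to (s := assignments a (N + 1) S e)
        (g := fun κ : ι → ℕ => ({i ∈ S | κ i = a} : Finset ι)) (t := S.powerset)
        (fun κ _ => Finset.mem_powerset.2 (Finset.filter_subset _ _))]
    refine Finset.sum_congr rfl fun I hI => ?_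
    rw [Finset.mem_powerset] at hI
    rw [filter_assignments a N hI e, ih (a + 1) (S \ I) (hy.mono (by simp))
      fun i => if i ∈ I then a else e i, map_sum, Finset.smul_sum]
    refine Finset.sum_congr rfl fun κ hκ => ?_
    obtain ⟨h1, h2⟩ := mem_assignments.1 hκ
    have h3 : ∀ i ∈ I, κ i = a := fun i hi => by
      rw [h2 i (by simp [hi]), if_pos hi]
    rw [map_smul, smul_smul, bulkWeight_split t y a hI h3 fun i hi => (h1 i hi).1, cre_pow_ket]
    congr 2
    rw [bulkState, bulkState, ← Finset.sum_sdiff hI, Finset.sum_congr (s₁ := I) rfl fun i hi => by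
      rw [h3 i hi], Finset.sum_const]

end Bulk

/-! ### Cosets, signs and comparison with the symmetrized sum -/

/-- The rearrangement of `λ` that belongs to a coset of its stabilizer. -/
def rearrange {n : ℕ} (lam : Fin n → ℕ) (q : Equiv.Perm (Fin n) ⧸ stab lam) : Fin n → ℕ :=
  Quotient.liftOn' q (fun σ i => lam (σ⁻¹ i)) (by
    intro σ ρ h
    have hτ : ∀ i, lam ((σ⁻¹ * ρ) i) = lam i := QuotientGroup.leftRel_apply.1 h
    funext i
    simpa using hτ (ρ⁻¹ i))

theorem rearrange_injective {n : ℕ} (lam : Fin n → ℕ) : Function.Injective (rearrange lam) := by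
  intro p q
  induction p using Quotient.inductionOn'
  induction q using Quotient.inductionOn'
  rename_i σ ρ
  intro h
  refine Quotient.sound' (QuotientGroup.leftRel_apply.2 fun i => ?_)
  have h1 : lam (σ⁻¹ (ρ i)) = lam (ρ⁻¹ (ρ i)) := congrFun h (ρ i)
  simpa using h1

theorem bulkState_univ {n : ℕ} (κ : Fin n → ℕ) : bulkState κ Finset.univ = partState κ := rfl

theorem partState_eq_iff {n : ℕ} (lam κ : Fin n → ℕ) :
    partState κ = partState lam ↔ ∃ q, rearrange lam q = κ := by
  constructor
  · intro h
    have hc : ∀ k, Nonempty ({i // κ i = k} ≃ {i // lam i = k}) := fun k => by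
      rw [← Fintype.card_eq, Fintype.card_subtype, Fintype.card_subtype, ← partState_inr,
        ← partState_inr, h]
    -- Equal states have equal multiplicities, so the fibres of `κ` and `lam` can be matched, giving
    -- `lam ∘ e = κ`. The coset is that of `e⁻¹` because `rearrange` composes with the inverse.
    let e : Equiv.Perm (Fin n) := Equiv.ofFiberEquiv fun k => (hc k).some
    refine ⟨QuotientGroup.mk e⁻¹, funext fun i => ?_⟩
    exact Equiv.ofFiberEquiv_map (fun k => (hc k).some) i
  · rintro ⟨q, rfl⟩
    induction q using Quotient.inductionOn'
    rename_i σ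
    exact Equiv.sum_comp σ⁻¹ fun i => Finsupp.single (Sum.inr (lam i)) 1

theorem lt_cutoff {n : ℕ} (lam : Fin n → ℕ) (i : Fin n) : lam i < cutoff (partState lam) := by
  by_contra h
  have h1 := eq_zero_of_cutoff_le (not_lt.1 h)
  rw [partState_inr, Finset.card_eq_zero] at h1
  exact Finset.notMem_empty i (h1 ▸ by simp)

/-- The matrix element of a product of single bulk rows is a Hall–Littlewood polynomial. -/
theorem bethe_monodromy_partState {n : ℕ} (lam : Fin n → ℕ) (t : F) {y : Fin n → F}
    (hy : Function.Injective y) :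
    bethe (fun u => monodromy t (bulkSites 0 (cutoff (partState lam))) u 0 1) y (ket F 0)
      Finset.univ (partState lam) =
      ∑ q, bulkWeight t y 0 (rearrange lam q) Finset.univ := by
  -- The default value `0` plays no role, since no index lies outside `Finset.univ`.
  rw [bethe_monodromy t _ _ _ hy.injOn fun _ => 0, Finset.sum_apply]
  simp only [Pi.smul_apply, smul_eq_mul, ket, Pi.single_apply, mul_ite, mul_one, mul_zero,
    bulkState_univ]
  rw [← Finset.sum_filter]
  symm
  refine Finset.sum_nbij (rearrange lam) (fun q _ => ?_) (rearrange_injective lam).injOn ?_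
    fun _ _ => rfl
  · rw [Finset.mem_filter, mem_assignments]
    have hq : partState (rearrange lam q) = partState lam := (partState_eq_iff _ _).2 ⟨q, rfl⟩
    refine ⟨⟨fun i _ => ⟨Nat.zero_le _, ?_⟩, fun i hi => absurd (Finset.mem_univ i) hi⟩, hq.symm⟩
    rw [zero_add, ← hq]
    exact lt_cutoff _ i
  · intro κ hκ
    obtain ⟨q, hq⟩ := (partState_eq_iff _ _).1 (Finset.mem_filter.1 hκ).2.symm
    exact ⟨q, by simp, hq⟩

/-- Reindexing by `σ` moves the permutation from the variables to the parts, the form in which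
lattice assignments appear. The product over `i < j` is symmetric, so `σ` drops out of it. -/
theorem summand_perm {n : ℕ} (lam : Fin n → ℕ) (t γ δ : F) (y : Fin n → F)
    (σ : Equiv.Perm (Fin n)) :
    summand lam t γ δ (fun i => y (σ i)) =
      (∏ i, y i ^ lam (σ⁻¹ i) * ((1 - γ * (y i)⁻¹) * (1 - δ * (y i)⁻¹) / (1 - (y i)⁻¹ ^ 2))) *
      (∏ i, ∏ j, if lam (σ⁻¹ j) < lam (σ⁻¹ i) then fcoef t (y j) (y i) else 1) *
      pairProd t y Finset.univ := by
  unfold summand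
  congr 1
  · congr 1
    · rw [← Equiv.prod_comp σ fun i => y i ^ lam (σ⁻¹ i) *
        ((1 - γ * (y i)⁻¹) * (1 - δ * (y i)⁻¹) / (1 - (y i)⁻¹ ^ 2))]
      simp
    · rw [Finset.prod_filter, Fintype.prod_prod_type, ← Equiv.prod_comp σ fun i => ∏ j,
        if lam (σ⁻¹ j) < lam (σ⁻¹ i) then fcoef t (y j) (y i) else 1]
      refine Finset.prod_congr rfl fun i _ => ?_
      rw [← Equiv.prod_comp σ fun j =>
        if lam (σ⁻¹ j) < lam (σ⁻¹ (σ i)) then fcoef t (y j) (y (σ i)) else 1]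
      simp [fcoef]
  · rw [prod_lt_comp (fun i j => (1 - t * (y i)⁻¹ * (y j)⁻¹) / (1 - (y i)⁻¹ * (y j)⁻¹))
      (fun i j => by ring) σ, Finset.prod_filter, Fintype.prod_prod_type, Finset.prod_comm,
      pairProd]
    refine Finset.prod_congr rfl fun i _ => ?_
    rw [Finset.prod_filter]
    refine Finset.prod_congr rfl fun j _ => ?_
    rw [pairFactor_comm]
    rfl

/-- The vector of signs that is `-1` exactly on `A`. -/
def signVec {n : ℕ} (A : Finset (Fin n)) (i : Fin n) : ℤˣ := if i ∈ A then -1 else 1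

theorem sum_signs {n : ℕ} {M : Type*} [AddCommMonoid M] (f : (Fin n → ℤˣ) → M) :
    ∑ ε, f ε = ∑ A : Finset (Fin n), f (signVec A) := by
  symm
  refine Finset.sum_nbij' signVec (fun ε => ({i | ε i = -1} : Finset (Fin n))) (by simp) (by simp)
    (fun A _ => ?_) (fun ε _ => ?_) (fun _ _ => rfl)
  · ext i
    by_cases h : i ∈ A <;> simp [signVec, h]
  · funext i
    rcases Int.units_eq_one_or (ε i) with h | h <;> simp [signVec, h]

/-- For `y = x^{±1}` one has `1/(1 - y⁻²) = y/(y - y⁻¹) = ± y/(x - x⁻¹)`. The sign produces `(-1) ^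
A.card`, and the extra `y` raises the exponent from `λ` to the lattice exponent `λ + 1`. -/
theorem signedTerm_eq {n : ℕ} (lam : Fin n → ℕ) (t γ δ : F) {x : Fin n → F}
    (hx0 : ∀ i, x i ≠ 0) (hx1 : ∀ i, x i ^ 2 ≠ 1) (q : Equiv.Perm (Fin n) ⧸ stab lam)
    (A : Finset (Fin n)) :
    signedTerm lam t γ δ x (q, signVec A) = (∏ i, (x i - (x i)⁻¹)⁻¹) *
      (boundaryCoef t (fun u => (1 - γ * u) * (1 - δ * u)) x Finset.univ A *
        bulkWeight t (invOn x A) 0 (rearrange lam q) Finset.univ) := by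
  induction q using Quotient.inductionOn'
  rename_i σ
  have hy : ∀ i, x i ^ (signVec A i : ℤ) = invOn x A i := fun i => by
    by_cases h : i ∈ A <;> simp [signVec, invOn, h]
  have h1 : signedTerm lam t γ δ x (Quotient.mk'' σ, signVec A) =
      summand lam t γ δ fun i => invOn x A (σ i) := by
    simp only [← hy]
    rfl
  have h2 : (-1 : F) ^ A.card = ∏ i, if i ∈ A then -1 else 1 := by simp
  have h3 : ∀ i, invOn x A i ^ lam (σ⁻¹ i) *
      ((1 - γ * (invOn x A i)⁻¹) * (1 - δ * (invOn x A i)⁻¹) / (1 - (invOn x A i)⁻¹ ^ 2)) =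
      (x i - (x i)⁻¹)⁻¹ * (if i ∈ A then -1 else 1) *
      ((1 - γ * (invOn x A i)⁻¹) * (1 - δ * (invOn x A i)⁻¹)) *
      invOn x A i ^ (lam (σ⁻¹ i) - 0 + 1) := by
    intro i
    have h4 : (1 - (invOn x A i)⁻¹ ^ 2)⁻¹ =
        (x i - (x i)⁻¹)⁻¹ * (if i ∈ A then -1 else 1) * invOn x A i := by
      have e1 := hx0 i
      have e2 : x i ^ 2 - 1 ≠ 0 := sub_ne_zero.2 (hx1 i)
      have e3 : 1 - x i ^ 2 ≠ 0 := sub_ne_zero.2 (hx1 i).symm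
      have e4 : (x i - (x i)⁻¹)⁻¹ = x i / (x i ^ 2 - 1) := by
        rw [← inv_div]; congr 1; field_simp
      have e5 : 1 - (x i)⁻¹ ^ 2 = (x i ^ 2 - 1) / x i ^ 2 := by field_simp
      unfold invOn
      split_ifs
      · rw [e4, inv_inv]; field_simp; ring
      · rw [e4, e5, inv_div]; field_simp
    rw [div_eq_mul_inv, h4, Nat.sub_zero, pow_succ]
    ring
  rw [h1, summand_perm, Finset.prod_congr rfl fun i _ => h3 i, boundaryCoef, bulkWeight, h2]
  simp only [Finset.prod_mul_distrib]
  change _ = (∏ i, (x i - (x i)⁻¹)⁻¹) * (_ * ((∏ i, invOn x A i ^ (lam (σ⁻¹ i) - 0 + 1)) *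
    ∏ i, ∏ j, if lam (σ⁻¹ j) < lam (σ⁻¹ i) then fcoef t (invOn x A j) (invOn x A i) else 1))
  ring

end BCHL

theorem mainTheorem6 {F : Type*} [Field F] (n : ℕ) (lam : Fin n → ℕ) (hlam : Antitone lam)
    (t γ δ : F) (x : Fin n → F)
    (hx0 : ∀ i, x i ≠ 0) (hx1 : ∀ i, x i ^ 2 ≠ 1) (hxt : ∀ i, x i ^ 2 ≠ t)
    (hxx : ∀ i j, i ≠ j → x i ≠ x j) (hxx' : ∀ i j, i ≠ j → x i * x j ≠ 1) :
    BCHL.hallLittlewoodK lam t γ δ x =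
      ∑ ω : BCHL.SignedCosets lam, BCHL.signedTerm lam t γ δ x ω := by
  open BCHL in
  have hne : ∏ i, (x i - t * (x i)⁻¹) ≠ 0 := by
    refine Finset.prod_ne_zero_iff.2 fun i _ e => hxt i ?_
    have := hx0 i
    field_simp at e
    linear_combination e
  have hl : ((List.finRange n).reverse).toFinset = Finset.univ := by ext; simp
  have hlist : (List.ofFn fun i => doubleRow t γ δ (x i)).reverse =
      (List.finRange n).reverse.map fun i => doubleRow t γ δ (x i) := by
    rw [List.ofFn_eq_map, List.map_reverse]
  rw [hallLittlewoodK, div_eq_iff hne, latticeSum, hlist, prod_doubleRow_apply,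
    (exchangeAlgebra_row t γ δ _).prod_doubleOp (fun u => row_vacuum t γ δ u _) hx0 hx1 hxx hxx' _
      (List.nodup_reverse.2 (List.nodup_finRange n)), hl, boundaryBethe, Fintype.sum_prod_type_right,
    sum_signs, Finset.powerset_univ, Pi.smul_apply, Finset.sum_apply, smul_eq_mul,
    Finset.mul_sum, Finset.sum_mul]
  refine Finset.sum_congr rfl fun A _ => ?_
  rw [Pi.smul_apply, bethe_row_apply _ _ _ _ _ _ _ (partState_inl lam),
    bethe_monodromy_partState lam t (invOn_injective hx0 hxx hxx'), smul_eq_mul,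
    Finset.sum_congr rfl fun q _ => signedTerm_eq lam t γ δ hx0 hx1 q A, ← Finset.mul_sum,
    ← Finset.mul_sum]
  -- The prefactor `∏ (x - t x⁻¹)/(x - x⁻¹)` splits into the normalization of `K` and the factor `∏
  -- (x - x⁻¹)⁻¹` of `signedTerm_eq`.
  simp only [div_eq_mul_inv, Finset.prod_mul_distrib]
  ring
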